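/- Let $f$ be an isolated singularity in three variables: $f$ is a nonzero holomorphic function in a neighbourhood of $0\in\mathbb{C}^3$ with $f(0)=0$, $\nabla f(0)=0$ and $\nabla f(z)\neq 0$ for all $z\neq 0$ sufficiently close to $0$. Let $\sum_\nu a_\nu z^\nu$ be the Taylor expansion of $f$ at $0$, and let $\Gamma_+(f)\subset\mathbb{R}^3$ be the convex hull of $\bigcup_{a_\nu\neq 0}(\nu+\mathbb{R}^3_{\ge 0})$. A face of $\Gamma_+(f)$ is a set $\{v\in\Gamma_+(f):\langle u,v\rangle=\inf_{w\in\Gamma_+(f)}\langle u,w\rangle\}$ with $u\in\mathbb{R}^3_{\ge 0}\setminus\{0\}$, and $\Gamma^k(f)$ denotes the set of compact $k$-dimensional faces of $\Gamma_+(f)$. A face $S\in\Gamma^2(f)$ is exceptional if, for some coordinate axis $OX_i$, one vertex of $S$ is at (Euclidean) distance $1$ from $OX_i$ and the other vertices of $S$ are the vertices of a $1$-dimensional face lying in a coordinate plane that contains $OX_i$; let $E_f\subset\Gamma^2(f)$ be the set of exceptional faces. Let $\mathcal{J}$ be the set of all segments $I_1^k=\overline{(0,1,1)(k,0,0)}$,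 $I_2^k=\overline{(1,0,1)(0,k,0)}$, $I_3^k=\overline{(1,1,0)(0,0,k)}$ with $k\in\{2,3,\ldots\}$. Then $$\bigl(\Gamma^2(f)=\emptyset\ \text{ or }\ \Gamma^2(f)=E_f\neq\emptyset\bigr)\iff \Gamma^1(f)\cap\mathcal{J}\neq\emptyset.$$ -/

import Mathlib

open Topology

/-- The gradient `∇f(z) = (∂f/∂z₁, …, ∂f/∂zₙ)(z)`. -/
noncomputable def grad {n : ℕ} (f : (Fin n → ℂ) → ℂ) (z : Fin n → ℂ) : Fin n → ℂ :=
  fun i => fderiv ℂ f z (Pi.single i 1)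

/-- `f` is (a representative of a germ of) an isolated singularity at the origin: holomorphic near
`0`, not identically zero near `0`, `f(0) = 0`, `∇f(0) = 0`, and `∇f(z) ≠ 0` for all `z ≠ 0`
sufficiently close to `0`. -/
structure IsIsolatedSingularity {n : ℕ} (f : (Fin n → ℂ) → ℂ) : Prop where
  analyticAt : AnalyticAt ℂ f 0
  germ_ne_zero : ¬ ∀ᶠ z in 𝓝 (0 : Fin n → ℂ), f z = 0
  map_zero : f 0 = 0
  grad_zero : grad f 0 = 0
  isolated : ∀ᶠ z in 𝓝[≠] (0 : Fin n → ℂ), grad f z ≠ 0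

/-- The Taylor coefficient `a_ν = (1 / ν!) ∂^{|ν|} f / ∂z^ν (0)` of `f` at the origin: the
`|ν|`-th derivative at `0` is evaluated on `ν₁` copies of `e₁`, then `ν₂` copies of `e₂`, etc. -/
noncomputable def taylorCoeff {n : ℕ} (f : (Fin n → ℂ) → ℂ) (ν : Fin n → ℕ) : ℂ :=
  (∏ i, ((ν i).factorial : ℂ))⁻¹ *
    iteratedFDeriv ℂ (∑ i, ν i) f 0 (fun k => Pi.single (finSigmaFinEquiv.symm k).1 1)

/-- The Newton diagram `Γ₊(f)`: the convex hull of the union of the sets `ν + ℝ₊ⁿ` over all `ν`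
with `a_ν ≠ 0`. -/
def newtonDiagram {n : ℕ} (f : (Fin n → ℂ) → ℂ) : Set (EuclideanSpace ℝ (Fin n)) :=
  convexHull ℝ {x | ∃ ν : Fin n → ℕ, taylorCoeff f ν ≠ 0 ∧ ∀ i, (ν i : ℝ) ≤ x i}

/-- `l(u, A) = inf {⟨u, v⟩ : v ∈ A}`. -/
noncomputable def supportValue {n : ℕ} (u : EuclideanSpace ℝ (Fin n))
    (A : Set (EuclideanSpace ℝ (Fin n))) : ℝ :=
  sInf ((fun v => inner ℝ u v) '' A)

/-- `Δ(u, A) = {v ∈ A : ⟨u, v⟩ = l(u, A)}`. -/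
def supportFace {n : ℕ} (u : EuclideanSpace ℝ (Fin n))
    (A : Set (EuclideanSpace ℝ (Fin n))) : Set (EuclideanSpace ℝ (Fin n)) :=
  {v ∈ A | inner ℝ u v = supportValue u A}

/-- The Newton boundary `Γ(f)`: the family of all compact faces `Δ(u, Γ₊(f))`,
`u ∈ ℝ₊ⁿ \ {0}`, of the Newton diagram. -/
def newtonBoundary {n : ℕ} (f : (Fin n → ℂ) → ℂ) : Set (Set (EuclideanSpace ℝ (Fin n))) :=
  {S | IsCompact S ∧ ∃ u : EuclideanSpace ℝ (Fin n),
    (∀ i, 0 ≤ u i) ∧ u ≠ 0 ∧ S = supportFace u (newtonDiagram f)}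

/-- `Γᵏ(f)`: the set of `k`-dimensional compact faces of the Newton diagram. -/
def compactFaces {n : ℕ} (f : (Fin n → ℂ) → ℂ) (k : ℕ) : Set (Set (EuclideanSpace ℝ (Fin n))) :=
  {S ∈ newtonBoundary f | Module.finrank ℝ (vectorSpan ℝ S) = k}

/-- The coordinate axis `OXᵢ`. -/
def coordAxis {n : ℕ} (i : Fin n) : Set (EuclideanSpace ℝ (Fin n)) :=
  {x | ∀ j, j ≠ i → x j = 0}

/-- The coordinate hyperplane `{xⱼ = 0}`; it includes the axis `OXᵢ` exactly when `j ≠ i`. -/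
def coordHyperplane {n : ℕ} (j : Fin n) : Set (EuclideanSpace ℝ (Fin n)) :=
  {x | x j = 0}

/-- For `n ≥ 2`: `S` is an exceptional face of `f` with respect to the axis `OXᵢ`, i.e. an
`(n-1)`-dimensional compact face one of whose vertices `W` is at (Euclidean) distance `1` from
`OXᵢ` and whose other vertices are the vertices of an `(n-2)`-dimensional face `T` lying in a
coordinate hyperplane that includes `OXᵢ`. -/
def IsExceptionalFace {n : ℕ} (f : (Fin n → ℂ) → ℂ) (i : Fin n)
    (S : Set (EuclideanSpace ℝ (Fin n))) : Prop :=
  S ∈ compactFaces f (n - 1) ∧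
    ∃ W ∈ Set.extremePoints ℝ S, Metric.infDist W (coordAxis i) = 1 ∧
      ∃ T ∈ compactFaces f (n - 2),
        Set.extremePoints ℝ T = Set.extremePoints ℝ S \ {W} ∧
          ∃ j, j ≠ i ∧ T ⊆ coordHyperplane j

/-- The set `E_f` of exceptional faces of `f`. -/
def exceptionalFaces {n : ℕ} (f : (Fin n → ℂ) → ℂ) : Set (Set (EuclideanSpace ℝ (Fin n))) :=
  {S | ∃ i, IsExceptionalFace f i S}

/-- The segment `I_j^k` in `ℝ³` joining the point whose `j`-th coordinate is `0` and whose other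
coordinates are `1` to the point `k e_j`; e.g. for the third axis, from `(1,1,0)` to `(0,0,k)`. -/
noncomputable def specialSegment (j : Fin 3) (k : ℕ) : Set (EuclideanSpace ℝ (Fin 3)) :=
  segment ℝ (WithLp.toLp 2 (fun i => if i = j then (0 : ℝ) else 1))
    (EuclideanSpace.single j (k : ℝ))

/-- The family `𝒥 = {I_j^k : j = 1, 2, 3, k = 2, 3, …}`. -/
def specialSegments : Set (Set (EuclideanSpace ℝ (Fin 3))) :=
  {I | ∃ (j : Fin 3) (k : ℕ), 2 ≤ k ∧ I = specialSegment j k}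

/-! The left side just says that every compact 2-face is exceptional
(`compactFaces_two_subset_iff`), and by Dickson's lemma the Newton diagram is generated by a finite
set `F` of exponents.

To find the edge, minimize `∑ u i` over the nonnegative weights that are at least `1` on `F`. This
linear program is dual to intersecting the diagonal with the Newton boundary. Take an extreme
minimizer. If its coordinates are positive, its active points span the space, so it cuts out a
compact 2-face. That face is exceptional: one active point is `p eᵢ + eⱼ`, the others have `j`-th
coordinate `0`. Moving the weight along `eᵢ - p eⱼ` stays feasible, so optimality gives `p ≤ 1`,
hence `p = 1`, and a small such move gives another minimizer, whose active points are `eᵢ + eⱼ` or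
lie on `OXₗ`. Optimality forces both kinds to occur. If some coordinate of the minimizer is zero,
the same move works, because an isolated singularity has an exponent near every axis and one in
every coordinate plane (`hasSpecialEdge_of_eq_zero`).

Conversely, let `[eᵢ + eⱼ, k eₗ]` be an edge. A compact face cannot have active points off `eᵢ + eⱼ`
on both sides of the plane `xᵢ = xⱼ`: a segment joining two such points would meet that plane
strictly above the line of the edge, yet the weight of the face does not allow this
(`forall_active_of_special_edge`). So a 2-face is a cone with apex `eᵢ + eⱼ` over a segment in a
coordinate plane (`isExceptionalFace_of_forall`). -/

/-! ### Three distinct indices of `Fin 3`. -/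

theorem Fin.sum_univ_three_of_ne {M : Type*} [AddCommMonoid M] {i j l : Fin 3} (hij : i ≠ j)
    (hil : i ≠ l) (hjl : j ≠ l) (g : Fin 3 → M) : ∑ m, g m = g i + g j + g l := by
  have h : (Finset.univ : Finset (Fin 3)) = {i, j, l} := by
    revert i j l; decide
  rw [h, Finset.sum_insert (by simp [hij, hil]), Finset.sum_insert (by simpa using hjl),
    Finset.sum_singleton, add_assoc]

theorem Fin.forall_of_ne_three {i j l : Fin 3} (hij : i ≠ j) (hil : i ≠ l) (hjl : j ≠ l)
    {p : Fin 3 → Prop} (hi : p i) (hj : p j) (hl : p l) (m : Fin 3) : p m := by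
  have h : m = i ∨ m = j ∨ m = l := by
    clear hi hj hl
    revert i j l m; decide
  rcases h with rfl | rfl | rfl <;> assumption

theorem Fin.exists_third {i j : Fin 3} (hij : i ≠ j) : ∃ l, i ≠ l ∧ j ≠ l := by
  revert i j; decide

/-! ### The linear program of minimal weights. -/

/-- The value at the lattice point `ν` of the linear form with coefficients `u`. -/
def latticeWeight {n : ℕ} (u : Fin n → ℝ) (ν : Fin n → ℕ) : ℝ := ∑ i, u i * ν i

theorem latticeWeight_add_smul {n : ℕ} (u v : Fin n → ℝ) (ε : ℝ) (ν : Fin n → ℕ) :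
    latticeWeight (u + ε • v) ν = latticeWeight u ν + ε * latticeWeight v ν := by
  simp only [latticeWeight, Pi.add_apply, Pi.smul_apply, smul_eq_mul, Finset.mul_sum,
    ← Finset.sum_add_distrib]
  exact Finset.sum_congr rfl fun i _ => by ring

theorem latticeWeight_eq_of_ne {i j l : Fin 3} (hij : i ≠ j) (hil : i ≠ l) (hjl : j ≠ l)
    (u : Fin 3 → ℝ) (ν : Fin 3 → ℕ) :
    latticeWeight u ν = u i * ν i + u j * ν j + u l * ν l :=
  Fin.sum_univ_three_of_ne hij hil hjl _

/-- The weights that are nonnegative and at least `1` on `F`. -/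
def feasibleWeights {n : ℕ} (F : Set (Fin n → ℕ)) : Set (Fin n → ℝ) :=
  {u | (∀ i, 0 ≤ u i) ∧ ∀ ν ∈ F, 1 ≤ latticeWeight u ν}

/-- The feasible weights whose coordinate sum is least possible. -/
def minimalWeights {n : ℕ} (F : Set (Fin n → ℕ)) : Set (Fin n → ℝ) :=
  {u ∈ feasibleWeights F | ∀ w ∈ feasibleWeights F, ∑ i, u i ≤ ∑ i, w i}

theorem isClosed_feasibleWeights {n : ℕ} (F : Set (Fin n → ℕ)) :
    IsClosed (feasibleWeights F) := by
  have h : feasibleWeights F =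
      (⋂ i, {u | 0 ≤ u i}) ∩ ⋂ ν ∈ F, {u | 1 ≤ latticeWeight u ν} := by
    ext u; simp [feasibleWeights]
  rw [h]
  refine (isClosed_iInter fun i => isClosed_le continuous_const (continuous_apply i)).inter
    (isClosed_biInter fun ν _ => isClosed_le continuous_const ?_)
  unfold latticeWeight
  fun_prop

theorem isCompact_feasibleWeights_inter {n : ℕ} (F : Set (Fin n → ℕ)) (C : ℝ) :
    IsCompact (feasibleWeights F ∩ {u | ∑ i, u i ≤ C}) := by
  refine (isCompact_Icc (a := (0 : Fin n → ℝ)) (b := fun _ => C)).of_isClosed_subset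
    ((isClosed_feasibleWeights F).inter (isClosed_le (by fun_prop) continuous_const)) ?_
  rintro u ⟨hu, hC⟩
  exact ⟨fun i => hu.1 i, fun i =>
    (Finset.single_le_sum (f := u) (fun i _ => hu.1 i) (Finset.mem_univ i)).trans hC⟩

theorem minimalWeights_nonempty {n : ℕ} {F : Set (Fin n → ℕ)} (h0 : 0 ∉ F) :
    (minimalWeights F).Nonempty := by
  have h1 : (fun _ => 1 : Fin n → ℝ) ∈ feasibleWeights F := by
    refine ⟨fun _ => zero_le_one, fun ν hν => ?_⟩
    obtain ⟨i, hi⟩ : ∃ i, ν i ≠ 0 := by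
      by_contra! h
      exact h0 (by rwa [show ν = 0 from funext h] at hν)
    have h2 : (1 : ℝ) ≤ ν i := by exact_mod_cast Nat.one_le_iff_ne_zero.2 hi
    refine h2.trans ?_
    simp only [latticeWeight, one_mul]
    exact Finset.single_le_sum (f := fun i => (ν i : ℝ)) (fun i _ => Nat.cast_nonneg _)
      (Finset.mem_univ i)
  obtain ⟨u, hu, hmin⟩ := (isCompact_feasibleWeights_inter F (∑ i : Fin n, 1)).exists_isMinOn
    ⟨_, h1, (le_refl (∑ _ : Fin n, (1 : ℝ)) :)⟩ (f := fun u => ∑ i, u i) (by fun_prop)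
  refine ⟨u, hu.1, fun w hw => ?_⟩
  rcases le_total (∑ i, w i) (∑ i : Fin n, 1) with h | h
  · exact hmin ⟨hw, h⟩
  · exact hu.2.trans h

theorem isCompact_minimalWeights {n : ℕ} (F : Set (Fin n → ℕ)) : IsCompact (minimalWeights F) := by
  rcases (minimalWeights F).eq_empty_or_nonempty with h | ⟨u, hu⟩
  · rw [h]; exact isCompact_empty
  · convert isCompact_feasibleWeights_inter F (∑ i, u i) using 1
    ext w
    exact ⟨fun hw => ⟨hw.1, hw.2 u hu.1⟩, fun hw => ⟨hw.1, fun x hx => hw.2.trans (hu.2 x hx)⟩⟩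

/-- A slack constraint stays slack for small `ε` by continuity; a tight one depends only on the sign
of `b`. -/
theorem eventually_add_mul_ge {a b c : ℝ} (ha : c ≤ a) (hb : a = c → 0 ≤ b) :
    ∀ᶠ ε in 𝓝[>] (0 : ℝ), c ≤ a + ε * b ∧ (a + ε * b = c → a = c ∧ b = 0) := by
  rcases ha.eq_or_lt with h | h
  · filter_upwards [self_mem_nhdsWithin] with ε hε
    have hb' := hb h.symm
    have h1 := mul_nonneg (le_of_lt hε) hb'
    refine ⟨by linarith, fun h2 => ⟨h.symm, ?_⟩⟩
    have : ε * b = 0 := by linarith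
    exact (mul_eq_zero.1 this).resolve_left (ne_of_gt hε)
  · have h1 : ContinuousAt (fun ε : ℝ => a + ε * b) 0 := by fun_prop
    have h2 := h1.eventually (lt_mem_nhds (a := c) (by simpa using h))
    filter_upwards [nhdsWithin_le_nhds h2] with ε hε
    exact ⟨hε.le, fun h3 => absurd h3 hε.ne'⟩

/-- Finiteness of `F` gives one `ε` for all constraints. No new constraint becomes tight, and a
tight one survives only if `v` is stationary on it; this is how active sets are shrunk later. -/
theorem exists_pos_perturbation {n : ℕ} {F : Set (Fin n → ℕ)} (hF : F.Finite) {u v : Fin n → ℝ}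
    (hu : u ∈ feasibleWeights F) (hv : ∀ ν ∈ F, latticeWeight u ν = 1 → 0 ≤ latticeWeight v ν)
    (hv0 : ∀ i, u i = 0 → 0 ≤ v i) :
    ∃ ε : ℝ, 0 < ε ∧ u + ε • v ∈ feasibleWeights F ∧
      (∀ ν ∈ F, latticeWeight (u + ε • v) ν = 1 → latticeWeight u ν = 1 ∧ latticeWeight v ν = 0) ∧
      ∀ i, (u + ε • v) i = 0 → u i = 0 ∧ v i = 0 := by
  have h1 := (Filter.eventually_all_finite hF).2 fun ν hν =>
    eventually_add_mul_ge (hu.2 ν hν) (hv ν hν)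
  have h2 := Filter.eventually_all.2 fun i => eventually_add_mul_ge (hu.1 i) (hv0 i)
  obtain ⟨ε, ⟨h1, h2⟩, hε⟩ := ((h1.and h2).and self_mem_nhdsWithin).exists
  refine ⟨ε, hε, ⟨fun i => (h2 i).1, fun ν hν => ?_⟩, fun ν hν h => ?_, fun i hi => (h2 i).2 hi⟩
  · rw [latticeWeight_add_smul]; exact (h1 ν hν).1
  · rw [latticeWeight_add_smul] at h; exact (h1 ν hν).2 h

theorem sum_perturbation_nonneg {n : ℕ} {F : Set (Fin n → ℕ)} (hF : F.Finite) {u v : Fin n → ℝ}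
    (hu : u ∈ minimalWeights F) (hv : ∀ ν ∈ F, latticeWeight u ν = 1 → 0 ≤ latticeWeight v ν)
    (hv0 : ∀ i, u i = 0 → 0 ≤ v i) : 0 ≤ ∑ i, v i := by
  obtain ⟨ε, hε, h, -⟩ := exists_pos_perturbation hF hu.1 hv hv0
  have h1 := hu.2 _ h
  simp only [Pi.add_apply, Pi.smul_apply, smul_eq_mul, Finset.sum_add_distrib,
    ← Finset.mul_sum] at h1
  exact nonneg_of_mul_nonneg_right (by linarith) hε

theorem add_smul_mem_minimalWeights {n : ℕ} {F : Set (Fin n → ℕ)} {u v : Fin n → ℝ} {ε : ℝ}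
    (hu : u ∈ minimalWeights F) (h : u + ε • v ∈ feasibleWeights F) (hv : ∑ i, v i = 0) :
    u + ε • v ∈ minimalWeights F := by
  refine ⟨h, fun w hw => ?_⟩
  simpa [Finset.sum_add_distrib, ← Finset.mul_sum, hv] using hu.2 w hw

/-- At an extreme point of the set of minimal weights, if it has positive coordinates, the
active lattice points span the space. -/
theorem eq_zero_of_latticeWeight_active {n : ℕ} {F : Set (Fin n → ℕ)} (hF : F.Finite)
    {u : Fin n → ℝ} (hu : u ∈ (minimalWeights F).extremePoints ℝ) (hpos : ∀ i, 0 < u i)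
    {v : Fin n → ℝ} (hv : ∀ ν ∈ F, latticeWeight u ν = 1 → latticeWeight v ν = 0) : v = 0 := by
  have hneg : ∀ ν, latticeWeight (-v) ν = -latticeWeight v ν := fun ν => by simp [latticeWeight]
  have hv' : ∀ ν ∈ F, latticeWeight u ν = 1 → latticeWeight (-v) ν = 0 := fun ν hν h => by
    rw [hneg, hv ν hν h, neg_zero]
  have hu0 : ∀ w : Fin n → ℝ, ∀ i, u i = 0 → 0 ≤ w i := fun _ i h => absurd h (hpos i).ne'
  have hsum : ∑ i, v i = 0 := by
    have h1 := sum_perturbation_nonneg hF hu.1 (fun ν hν h => (hv ν hν h).ge) (hu0 v)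
    have h2 := sum_perturbation_nonneg hF hu.1 (fun ν hν h => (hv' ν hν h).ge) (hu0 (-v))
    simp only [Pi.neg_apply, Finset.sum_neg_distrib] at h2
    linarith
  obtain ⟨ε, hε, h1, -⟩ :=
    exists_pos_perturbation hF hu.1.1 (fun ν hν h => (hv ν hν h).ge) (hu0 v)
  obtain ⟨δ, hδ, h2, -⟩ :=
    exists_pos_perturbation hF hu.1.1 (fun ν hν h => (hv' ν hν h).ge) (hu0 (-v))
  have h3 := add_smul_mem_minimalWeights hu.1 h1 hsum
  have h4 := add_smul_mem_minimalWeights hu.1 h2 (by simp [hsum])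
  -- `u` is the convex combination of `u + ε v` and `u - δ v` with weights `δ / (ε + δ)` and `ε / (ε
  -- + δ)`, so extremality forces `u + ε v = u`.
  have h5 := hu.2 h3 h4 ⟨δ / (ε + δ), ε / (ε + δ), by positivity, by positivity, by field_simp; ring,
    by ext i; simp; field_simp; ring⟩
  simpa [hε.ne'] using h5

/-! ### From a minimal weight to a special edge. -/

/-- `F` has an edge of the form `[eᵢ + eⱼ, k eₗ]`: a weight with positive coordinates whose
minimum over `F` is `1`, attained exactly at these two lattice points. -/
def HasSpecialEdge (F : Set (Fin 3 → ℕ)) : Prop :=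
  ∃ i j l : Fin 3, i ≠ j ∧ i ≠ l ∧ j ≠ l ∧ ∃ k : ℕ, 2 ≤ k ∧ ∃ u : Fin 3 → ℝ,
    (∀ i, 0 < u i) ∧ (∀ ν ∈ F, 1 ≤ latticeWeight u ν) ∧
      {ν ∈ F | latticeWeight u ν = 1} = {Pi.single i 1 + Pi.single j 1, Pi.single l k}

theorem eq_single_add_single {i j l : Fin 3} (hij : i ≠ j) (hil : i ≠ l) (hjl : j ≠ l)
    {ν : Fin 3 → ℕ} (hi : ν i = 1) (hj : ν j = 1) (hl : ν l = 0) :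
    ν = Pi.single i 1 + Pi.single j 1 :=
  funext <| Fin.forall_of_ne_three hij hil hjl (by simp [hi, hij]) (by simp [hj, hij.symm])
    (by simp [hl, hil.symm, hjl.symm])

theorem eq_single_of_ne {i j l : Fin 3} (hij : i ≠ j) (hil : i ≠ l) (hjl : j ≠ l)
    {ν : Fin 3 → ℕ} (hi : ν i = 0) (hj : ν j = 0) : ν = Pi.single l (ν l) :=
  funext <| Fin.forall_of_ne_three hij hil hjl (by simp [hi, hil]) (by simp [hj, hjl]) (by simp)

theorem hasSpecialEdge_of_active_subset {F : Set (Fin 3 → ℕ)} (hF : F.Finite)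
    (hA : ∀ ν ∈ F, 2 ≤ ∑ i, ν i) {u : Fin 3 → ℝ} (hu : u ∈ minimalWeights F)
    (hpos : ∀ i, 0 < u i) {i j l : Fin 3} (hij : i ≠ j) (hil : i ≠ l) (hjl : j ≠ l)
    (hact : ∀ ν ∈ F, latticeWeight u ν = 1 →
      ν = Pi.single i 1 + Pi.single j 1 ∨ ν i = 0 ∧ ν j = 0) : HasSpecialEdge F := by
  -- If every active point had `m`-th coordinate zero, `u m` could be decreased, contradicting
  -- minimality.
  have key : ∀ m : Fin 3, ∃ ν ∈ F, latticeWeight u ν = 1 ∧ ν m ≠ 0 := by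
    intro m
    by_contra! h
    have h1 := sum_perturbation_nonneg hF (v := -Pi.single m 1) hu
      (fun ν hν h1 => by simp [latticeWeight, Pi.single_apply, h ν hν h1])
      (fun i h => absurd h (hpos i).ne')
    simp only [Pi.neg_apply, Finset.sum_neg_distrib, Finset.sum_pi_single', Finset.mem_univ,
      if_true] at h1
    linarith
  obtain ⟨ω, hω, hω1, hωi⟩ := key i
  have hω2 := (hact ω hω hω1).resolve_right fun h => hωi h.1
  subst hω2
  obtain ⟨κ, hκ, hκ1, hκl⟩ := key l
  have hκ2 := (hact κ hκ hκ1).resolve_left (by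
    rintro rfl
    simp [hil.symm, hjl.symm] at hκl)
  have hκ3 := eq_single_of_ne hij hil hjl hκ2.1 hκ2.2
  have hk := hA κ hκ
  rw [Fin.sum_univ_three_of_ne hij hil hjl, hκ2.1, hκ2.2, zero_add, zero_add] at hk
  refine ⟨i, j, l, hij, hil, hjl, κ l, hk, u, hpos, hu.1.2, ?_⟩
  ext ν
  simp only [Set.mem_ofPred_eq, Set.mem_insert_iff, Set.mem_singleton_iff]
  constructor
  · rintro ⟨hν, hν1⟩
    refine (hact ν hν hν1).imp_right fun h => ?_
    have h1 : u l * ν l = u l * κ l := by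
      rw [latticeWeight_eq_of_ne hij hil hjl] at hν1 hκ1
      rw [h.1, h.2] at hν1
      rw [hκ2.1, hκ2.2] at hκ1
      simp at hν1 hκ1
      rw [hν1, hκ1]
    have h2 : ν l = κ l := by exact_mod_cast mul_left_cancel₀ (hpos l).ne' h1
    rw [← h2]
    exact eq_single_of_ne hij hil hjl h.1 h.2
  · rintro (rfl | rfl)
    · exact ⟨hω, hω1⟩
    · rw [← hκ3]; exact ⟨hκ, hκ1⟩

theorem latticeWeight_single_sub {i j l : Fin 3} (hij : i ≠ j) (hil : i ≠ l) (hjl : j ≠ l) (p : ℝ)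
    (ν : Fin 3 → ℕ) :
    latticeWeight (Pi.single i 1 - Pi.single j p) ν = ν i - p * ν j := by
  rw [latticeWeight_eq_of_ne hij hil hjl]
  simp [hij, hij.symm, hil.symm, hjl.symm]
  ring

theorem sum_single_sub (i j : Fin 3) (p : ℝ) :
    ∑ m, (Pi.single i 1 - Pi.single j p : Fin 3 → ℝ) m = 1 - p := by
  simp

/-- With `u i = 0`, an exponent near `OXᵢ` forces `u j ≥ 1`, and an exponent with `j`-th coordinate
zero then forces `u l > 0`. Hence an active point has `j`-th coordinate `0` or is `p eᵢ + eⱼ` with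
`p ≥ 1`. Shifting weight from `j` to `i` keeps the sum, makes all coordinates positive and leaves
active only points with equal `i`-th and `j`-th coordinates. -/
theorem hasSpecialEdge_of_eq_zero {F : Set (Fin 3 → ℕ)} (hF : F.Finite)
    (hA : ∀ ν ∈ F, 2 ≤ ∑ i, ν i)
    (hB : ∀ i, ∃ ν ∈ F, ∃ j, j ≠ i ∧ ν j ≤ 1 ∧ ∀ l, l ≠ i → l ≠ j → ν l = 0)
    (hC : ∀ j, ∃ ν ∈ F, ν j = 0) {u : Fin 3 → ℝ} (hu : u ∈ minimalWeights F)
    {i : Fin 3} (hi : u i = 0) : HasSpecialEdge F := by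
  obtain ⟨ν, hν, j, hji, hj1, hν0⟩ := hB i
  obtain ⟨l, hil, hjl⟩ := Fin.exists_third hji.symm
  have hij := hji.symm
  have hw := latticeWeight_eq_of_ne hij hil hjl u
  have huj : 1 ≤ u j := by
    have h := hu.1.2 ν hν
    rw [hw, hi, hν0 l hil.symm hjl.symm] at h
    have h0 := hu.1.1 j
    have h1 : (ν j : ℝ) ≤ 1 := by exact_mod_cast hj1
    simp at h
    nlinarith
  have hul : 0 < u l := by
    refine (hu.1.1 l).lt_of_ne fun h => ?_
    obtain ⟨μ, hμ, hμj⟩ := hC j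
    have h1 := hu.1.2 μ hμ
    rw [hw, hi, hμj, ← h] at h1
    simp at h1
    linarith
  have hact : ∀ ν ∈ F, latticeWeight u ν = 1 → (ν j = 1 ∧ ν l = 0 ∧ 1 ≤ ν i) ∨ ν j = 0 := by
    intro ν hν h
    rw [hw, hi, zero_mul, zero_add] at h
    have hl0 : 0 ≤ u l * ν l := mul_nonneg hul.le (Nat.cast_nonneg _)
    rcases Nat.eq_zero_or_pos (ν j) with h0 | h0
    · exact Or.inr h0
    · left
      have h1 : (1 : ℝ) ≤ ν j := by exact_mod_cast h0
      have h2 : (ν j : ℝ) ≤ 1 := by nlinarith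
      have h3 : u l * ν l = 0 := by nlinarith
      have h4 : ν l = 0 := by
        exact_mod_cast (mul_eq_zero.1 h3).resolve_left hul.ne'
      have h5 : ν j = 1 := le_antisymm (by exact_mod_cast h2) h0
      have h6 := hA ν hν
      rw [Fin.sum_univ_three_of_ne hij hil hjl] at h6
      exact ⟨h5, h4, by omega⟩
  have hv := latticeWeight_single_sub hij hil hjl 1
  obtain ⟨ε, hε, hfeas, hact', hzero⟩ := exists_pos_perturbation hF
    (v := Pi.single i 1 - Pi.single j 1) hu.1
    (fun ν hν h => by
      rw [hv]
      rcases hact ν hν h with ⟨h1, -, h2⟩ | h1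
      · have h3 : (1 : ℝ) ≤ ν i := by exact_mod_cast h2
        simp [h1, h3]
      · simp [h1])
    (Fin.forall_of_ne_three hij hil hjl (fun _ => by simp [hij])
      (fun h => by linarith) (fun h => by linarith))
  refine hasSpecialEdge_of_active_subset hF hA
    (add_smul_mem_minimalWeights hu hfeas (by simp))
    (fun m => (hfeas.1 m).lt_of_ne fun h => ?_) hij hil hjl fun ν hν h => ?_
  · obtain ⟨h1, h2⟩ := hzero m h.symm
    have h3 : ∀ m, u m = 0 → (Pi.single i 1 - Pi.single j 1 : Fin 3 → ℝ) m ≠ 0 :=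
      Fin.forall_of_ne_three hij hil hjl (fun _ => by simp [hij])
        (fun h => by linarith) (fun h => by linarith)
    exact h3 m h1 h2
  · obtain ⟨h1, h2⟩ := hact' ν hν h
    rw [hv] at h2
    rcases hact ν hν h1 with ⟨h3, h4, -⟩ | h3
    · left
      refine eq_single_add_single hij hil hjl ?_ h3 h4
      rw [h3, Nat.cast_one] at h2
      exact_mod_cast (by linarith : (ν i : ℝ) = 1)
    · right
      rw [h3] at h2
      exact ⟨by exact_mod_cast (by simpa using h2 : (ν i : ℝ) = 0), h3⟩

theorem hasSpecialEdge_of_exceptional {F : Set (Fin 3 → ℕ)} (hF : F.Finite)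
    (hA : ∀ ν ∈ F, 2 ≤ ∑ i, ν i)
    (hB : ∀ i, ∃ ν ∈ F, ∃ j, j ≠ i ∧ ν j ≤ 1 ∧ ∀ l, l ≠ i → l ≠ j → ν l = 0)
    (hC : ∀ j, ∃ ν ∈ F, ν j = 0)
    (hE : ∀ u : Fin 3 → ℝ, (∀ i, 0 < u i) → (∀ ν ∈ F, 1 ≤ latticeWeight u ν) →
      (∀ v : Fin 3 → ℝ, (∀ ν ∈ F, latticeWeight u ν = 1 → latticeWeight v ν = 0) → v = 0) →
      ∃ i j, i ≠ j ∧ ∃ ω ∈ F, ω j = 1 ∧ (∀ l, l ≠ i → l ≠ j → ω l = 0) ∧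
        ∀ ν ∈ F, latticeWeight u ν = 1 → ν ≠ ω → ν j = 0) :
    HasSpecialEdge F := by
  have h0 : (0 : Fin 3 → ℕ) ∉ F := fun h => by simpa using hA 0 h
  obtain ⟨u, hu⟩ := (isCompact_minimalWeights F).extremePoints_nonempty (minimalWeights_nonempty h0)
  by_cases hz : ∃ i, u i = 0
  · obtain ⟨i, hi⟩ := hz
    exact hasSpecialEdge_of_eq_zero hF hA hB hC hu.1 hi
  push Not at hz
  have hpos : ∀ i, 0 < u i := fun i => (hu.1.1.1 i).lt_of_ne (hz i).symm
  obtain ⟨i, j, hij, ω, hω, hωj, hωl, hν⟩ := hE u hpos hu.1.1.2 fun v hv =>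
    eq_zero_of_latticeWeight_active hF hu hpos hv
  obtain ⟨l, hil, hjl⟩ := Fin.exists_third hij
  have hωl := hωl l hil.symm hjl.symm
  have hp : 1 ≤ ω i := by
    have := hA ω hω
    rw [Fin.sum_univ_three_of_ne hij hil hjl] at this
    omega
  have hv := latticeWeight_single_sub hij hil hjl (ω i)
  -- The direction `eᵢ - (ω i) eⱼ` is chosen to be stationary on `ω`; it is nonnegative on the other
  -- active points, whose `j`-th coordinate vanishes.
  have hvF : ∀ ν ∈ F, latticeWeight u ν = 1 →
      0 ≤ latticeWeight (Pi.single i 1 - Pi.single j (ω i : ℝ)) ν := by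
    intro ν hν' h
    rw [hv]
    rcases eq_or_ne ν ω with rfl | hne
    · simp [hωj]
    · simp [hν ν hν' h hne]
  -- The direction has coordinate sum `1 - ω i`, which optimality makes nonnegative.
  have hωi : ω i = 1 := by
    have h := sum_perturbation_nonneg hF hu.1 hvF fun i h => absurd h (hz i)
    rw [sum_single_sub] at h
    exact le_antisymm (by exact_mod_cast (by linarith : (ω i : ℝ) ≤ 1)) hp
  obtain ⟨ε, hε, hfeas, hact, hzero⟩ := exists_pos_perturbation hF hu.1.1 hvF
    fun i h => absurd h (hz i)
  refine hasSpecialEdge_of_active_subset hF hA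
    (add_smul_mem_minimalWeights hu.1 hfeas (by simp [hωi]))
    (fun m => (hfeas.1 m).lt_of_ne fun h => hz m (hzero m h.symm).1) hij hil hjl fun ν hν' h => ?_
  obtain ⟨h1, h2⟩ := hact ν hν' h
  rcases eq_or_ne ν ω with rfl | hne
  · exact Or.inl (eq_single_add_single hij hil hjl hωi hωj hωl)
  · have h3 := hν ν hν' h1 hne
    rw [hv, h3] at h2
    exact Or.inr ⟨by exact_mod_cast (by simpa using h2 : (ν i : ℝ) = 0), h3⟩

/-! ### Zeros of a holomorphic function of two variables. -/

/-- If the zero at the origin were isolated, then for small `x ≠ 0` the function `1 / G(x, ·)` would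
be holomorphic on a disc, bounded by `1 / m` on its boundary but larger than `1 / m` at the centre,
against the maximum principle. -/
theorem exists_zero_ne_of_analyticAt {G : ℂ × ℂ → ℂ} (hG : AnalyticAt ℂ G 0) (h0 : G 0 = 0) :
    ∃ᶠ p in 𝓝[≠] (0 : ℂ × ℂ), G p = 0 := by
  intro hne
  rw [eventually_nhdsWithin_iff] at hne
  obtain ⟨r, hr, hball⟩ := Metric.nhds_basis_closedBall.eventually_iff.1
    (hne.and hG.eventually_analyticAt)
  have hmem : ∀ {x y : ℂ}, ‖x‖ ≤ r → ‖y‖ ≤ r → (x, y) ∈ Metric.closedBall (0 : ℂ × ℂ) r := by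
    intro x y hx hy
    simpa [Prod.norm_def] using ⟨hx, hy⟩
  have hnz : ∀ {x y : ℂ}, ‖x‖ ≤ r → ‖y‖ ≤ r → (x, y) ≠ (0 : ℂ × ℂ) → G (x, y) ≠ 0 :=
    fun hx hy => (hball (hmem hx hy)).1
  have hcont : ∀ {x y : ℂ}, ‖x‖ ≤ r → ‖y‖ ≤ r → DifferentiableAt ℂ G (x, y) :=
    fun hx hy => (hball (hmem hx hy)).2.differentiableAt
  have hr0 : ‖(0 : ℂ)‖ ≤ r := by simpa using hr.le
  obtain ⟨y₀, hy₀, hmin⟩ := (isCompact_sphere (0 : ℂ) r).exists_isMinOn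
    (NormedSpace.sphere_nonempty.2 hr.le) (f := fun y => ‖G (0, y)‖) (by
      intro y hy
      have hy' : ‖y‖ ≤ r := by simpa using (mem_sphere_zero_iff_norm.1 hy).le
      have h1 := (hcont hr0 hy').continuousAt
      have h2 : ContinuousAt (fun y : ℂ => ((0 : ℂ), y)) y := by fun_prop
      exact (ContinuousAt.comp (f := fun y : ℂ => ((0 : ℂ), y)) h1 h2).norm.continuousWithinAt)
  have hy₀r : ‖y₀‖ = r := mem_sphere_zero_iff_norm.1 hy₀
  have hpos : 0 < ‖G (0, y₀)‖ := norm_pos_iff.2 <| hnz hr0 hy₀r.le fun h => by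
    rw [Prod.mk_eq_zero] at h
    rw [h.2, norm_zero] at hy₀r
    exact hr.ne hy₀r
  obtain ⟨m, hm0, hm⟩ := exists_between hpos
  have hK := (isCompact_sphere (0 : ℂ) r).eventually_forall_of_forall_eventually (x₀ := (0 : ℂ))
    (P := fun x y => m < ‖G (x, y)‖) fun y hy =>
      (hcont hr0 (mem_sphere_zero_iff_norm.1 hy).le).continuousAt.norm.eventually
        (lt_mem_nhds (hm.trans_le (hmin hy)))
  have hsmall : ∀ᶠ x in 𝓝 (0 : ℂ), ‖G (x, 0)‖ < m := by
    have h2 : ContinuousAt (fun x : ℂ => (x, (0 : ℂ))) 0 := by fun_prop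
    have h1 : ContinuousAt (fun x : ℂ => ‖G (x, 0)‖) 0 :=
      (ContinuousAt.comp (f := fun x : ℂ => (x, (0 : ℂ))) (hcont hr0 hr0).continuousAt h2).norm
    refine h1.eventually (gt_mem_nhds ?_)
    change ‖G 0‖ < m
    rwa [h0, norm_zero]
  -- `x ≠ 0` keeps the whole slice away from the origin, the only zero.
  obtain ⟨x, hx0, ⟨hx1, hx2⟩, hx3⟩ := (Filter.Eventually.and (self_mem_nhdsWithin (s := {0}ᶜ))
    (((hK.and hsmall).and (Metric.closedBall_mem_nhds (0 : ℂ) hr)).filter_mono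
      nhdsWithin_le_nhds)).exists
  have hx3 : ‖x‖ ≤ r := by simpa using hx3
  have hxne : ∀ y, (x, y) ≠ (0 : ℂ × ℂ) := fun y h => hx0 (Prod.mk_eq_zero.1 h).1
  have hd : DifferentiableOn ℂ (fun y => (G (x, y))⁻¹) (closure (Metric.ball 0 r)) := by
    intro y hy
    rw [closure_ball _ hr.ne', mem_closedBall_zero_iff] at hy
    have h2 : DifferentiableAt ℂ (fun y : ℂ => (x, y)) y := by fun_prop
    exact ((DifferentiableAt.comp (f := fun y : ℂ => (x, y)) y (hcont hx3 hy) h2).inv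
      (hnz hx3 hy (hxne y))).differentiableWithinAt
  have hmax := Complex.norm_le_of_forall_mem_frontier_norm_le Metric.isBounded_ball
    hd.diffContOnCl (C := m⁻¹) (fun y hy => by
      rw [frontier_ball _ hr.ne'] at hy
      rw [norm_inv]
      exact inv_anti₀ hm0 (hx1 y hy).le) (subset_closure (Metric.mem_ball_self hr))
  rw [norm_inv, inv_le_inv₀ (norm_pos_iff.2 (hnz hx3 hr0 (hxne 0))) hm0] at hmax
  exact hmax.not_gt hx2

/-! ### Vanishing of Taylor coefficients and of the gradient. -/

section Taylor

variable {n : ℕ} {f : (Fin n → ℂ) → ℂ}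

theorem iteratedFDeriv_comp_equiv {E F : Type*} [NormedAddCommGroup E] [NormedSpace ℂ E]
    [NormedAddCommGroup F] [NormedSpace ℂ F] [CompleteSpace F] {f : E → F} {x : E}
    (hf : AnalyticAt ℂ f x) {m m' : ℕ} (σ : Fin m ≃ Fin m') (v : Fin m' → E) :
    iteratedFDeriv ℂ m f x (v ∘ σ) = iteratedFDeriv ℂ m' f x v := by
  obtain rfl : m = m' := by simpa using Fintype.card_congr σ
  exact hf.contDiffAt.iteratedFDeriv_comp_perm v σ

/-- The number of indices at which `r` takes each value. -/
def indexCount {m n : ℕ} (r : Fin m → Fin n) (i : Fin n) : ℕ :=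
  Fintype.card {k // r k = i}

/-- `taylorCoeff` evaluates on basis vectors in sorted order. Grouping the positions by the value of
`r` sorts them, and the derivative is symmetric. -/
theorem iteratedFDeriv_single_eq_zero (hf : AnalyticAt ℂ f 0) {m : ℕ} (r : Fin m → Fin n)
    (h : taylorCoeff f (indexCount r) = 0) :
    iteratedFDeriv ℂ m f 0 (fun k => Pi.single (r k) 1) = 0 := by
  let e : Fin m ≃ Σ i, Fin (indexCount r i) :=
    (Equiv.sigmaFiberEquiv r).symm.trans
      (Equiv.sigmaCongrRight fun i => Fintype.equivFinOfCardEq rfl)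
  have he : ∀ k, (e k).1 = r k := fun k => rfl
  have h1 := iteratedFDeriv_comp_equiv hf (e.trans finSigmaFinEquiv)
    fun k => Pi.single (finSigmaFinEquiv.symm k).1 1
  have h2 : (∏ i, ((indexCount r i).factorial : ℂ)) ≠ 0 :=
    Finset.prod_ne_zero_iff.2 fun i _ => by exact_mod_cast Nat.factorial_ne_zero _
  rw [taylorCoeff, mul_eq_zero, or_iff_right (inv_ne_zero h2), ← h1] at h
  convert h using 2
  funext k
  simp [he]

theorem two_le_sum_of_taylorCoeff_ne_zero (h0 : f 0 = 0) (h1 : grad f 0 = 0) {ν : Fin n → ℕ}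
    (hν : taylorCoeff f ν ≠ 0) : 2 ≤ ∑ i, ν i := by
  by_contra! h
  have key : ∀ (m : ℕ) (r : Fin m → Fin n), m < 2 →
      iteratedFDeriv ℂ m f 0 (fun k => Pi.single (r k) 1) = 0 := by
    intro m r hm
    interval_cases m
    · simpa using h0
    · simpa [iteratedFDeriv_one_apply, grad] using congrFun h1 (r 0)
  apply hν
  rw [taylorCoeff, key _ (fun k => (finSigmaFinEquiv.symm k).1) h, mul_zero]

theorem eventually_eq_zero_of_iteratedFDeriv {E : Type*} [NormedAddCommGroup E] [NormedSpace ℂ E]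
    {g : E → ℂ} (hg : AnalyticAt ℂ g 0) {s : Set E}
    (h : ∀ z ∈ s, ∀ m, iteratedFDeriv ℂ m g 0 (fun _ => z) = 0) :
    ∀ᶠ z in 𝓝 (0 : E), z ∈ s → g z = 0 := by
  obtain ⟨p, r, hp⟩ := hg
  filter_upwards [Metric.eball_mem_nhds (0 : E) hp.r_pos] with z hz hzs
  have h1 := hp.hasSum_iteratedFDeriv hz
  simp only [h z hzs, smul_zero, zero_add] at h1
  exact h1.unique hasSum_zero

theorem analyticAt_fderiv_apply (hf : AnalyticAt ℂ f 0) (v : Fin n → ℂ) :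
    AnalyticAt ℂ (fun z => fderiv ℂ f z v) 0 :=
  ((ContinuousLinearMap.apply ℂ ℂ v).analyticAt _).comp hf.fderiv

/-- The Taylor coefficients of `∂f/∂zⱼ` along `OXᵢ` are multiples of those of `f` at `m eᵢ + eⱼ`,
which is the index count of the sequence `i, …, i, j`. -/
theorem eventually_grad_eq_zero_on_axis (hf : AnalyticAt ℂ f 0) (i : Fin n)
    (h : ∀ (m : ℕ) (j : Fin n),
      taylorCoeff f (indexCount (Fin.snoc (fun _ : Fin m => i) j : Fin (m + 1) → Fin n)) = 0) :
    ∀ᶠ t in 𝓝 (0 : ℂ), grad f (Pi.single i t) = 0 := by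
  have h1 : ∀ j, ∀ᶠ z in 𝓝 (0 : Fin n → ℂ), z ∈ Set.range (fun t : ℂ => (Pi.single i t : Fin n → ℂ)) →
      fderiv ℂ f z (Pi.single j 1) = 0 := by
    intro j
    refine eventually_eq_zero_of_iteratedFDeriv (analyticAt_fderiv_apply hf _) ?_
    rintro _ ⟨t, rfl⟩ m
    have h2 := iteratedFDeriv_single_eq_zero hf _ (h m j)
    rw [iteratedFDeriv_succ_apply_right] at h2
    have h5 := (ContinuousLinearMap.apply ℂ ℂ (Pi.single j 1 : Fin n → ℂ)).iteratedFDeriv_comp_left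
      (hf.fderiv.contDiffAt (n := ⊤)) (i := m) le_top
    change iteratedFDeriv ℂ m (fun z => fderiv ℂ f z (Pi.single j 1)) 0 = _ at h5
    rw [h5, ContinuousLinearMap.compContinuousMultilinearMap_coe, Function.comp_apply,
      ContinuousLinearMap.apply_apply]
    beta_reduce
    have h3 : (Pi.single i t : Fin n → ℂ) = t • Pi.single i 1 := by simp [← Pi.single_smul]
    rw [h3, ContinuousMultilinearMap.map_smul_univ (iteratedFDeriv ℂ m (fderiv ℂ f) 0)
      (fun _ => t) (fun _ => Pi.single i 1)]
    have h4 : Fin.init (fun k => (Pi.single ((Fin.snoc (fun _ : Fin m => i) j : Fin (m + 1) → Fin n)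
        k) 1 : Fin n → ℂ)) = fun _ => Pi.single i 1 := by
      funext k; simp [Fin.init]
    rw [h4, Fin.snoc_last] at h2
    rw [_root_.smul_apply, h2, smul_zero]
  have h2 : Filter.Tendsto (fun t => (Pi.single i t : Fin n → ℂ)) (𝓝 0) (𝓝 0) := by
    have : Continuous (fun t => (Pi.single i t : Fin n → ℂ)) :=
      continuous_single (A := fun _ => ℂ) i
    simpa using this.tendsto 0
  filter_upwards [h2.eventually (Filter.eventually_all.2 h1)] with t ht
  exact funext fun j => ht j ⟨t, rfl⟩

/-- After multilinear expansion in the basis, each term either contains the factor `z j = 0` or has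
an exponent with `j`-th coordinate zero. -/
theorem eventually_eq_zero_on_hyperplane (hf : AnalyticAt ℂ f 0) (j : Fin n)
    (h : ∀ ν : Fin n → ℕ, ν j = 0 → taylorCoeff f ν = 0) :
    ∀ᶠ z in 𝓝 (0 : Fin n → ℂ), z j = 0 → f z = 0 := by
  refine eventually_eq_zero_of_iteratedFDeriv (s := {z | z j = 0}) hf fun z hz m => ?_
  have h1 : z = ∑ i, z i • (Pi.single i 1 : Fin n → ℂ) := by
    simpa [← Pi.single_smul] using (Finset.univ_sum_single z).symm
  have h2 := ContinuousMultilinearMap.map_sum (iteratedFDeriv ℂ m f 0)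
    (fun (_ : Fin m) i => z i • (Pi.single i 1 : Fin n → ℂ))
  rw [← h1] at h2
  rw [h2]
  refine Finset.sum_eq_zero fun r _ => ?_
  rw [ContinuousMultilinearMap.map_smul_univ (iteratedFDeriv ℂ m f 0) (fun k => z (r k))
    (fun k => Pi.single (r k) 1)]
  by_cases hr : ∃ k, r k = j
  · obtain ⟨k, hk⟩ := hr
    rw [Finset.prod_eq_zero (Finset.mem_univ k) (by rw [hk]; exact hz), zero_smul]
  · rw [iteratedFDeriv_single_eq_zero hf r (h _ ?_), smul_zero]
    rw [indexCount, Fintype.card_eq_zero_iff]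
    exact ⟨fun k => hr ⟨k.1, k.2⟩⟩

theorem eventually_grad_apply_eq_zero_on_hyperplane (hf : AnalyticAt ℂ f 0) {j : Fin n}
    (h : ∀ᶠ z in 𝓝 (0 : Fin n → ℂ), z j = 0 → f z = 0) :
    ∀ᶠ z in 𝓝 (0 : Fin n → ℂ), z j = 0 → ∀ l, l ≠ j → grad f z l = 0 := by
  filter_upwards [h.eventually_nhds, hf.eventually_analyticAt] with z hz hfz hzj l hl
  have h1 : HasDerivAt (fun t : ℂ => z + t • (Pi.single l 1 : Fin n → ℂ)) (Pi.single l 1) 0 := by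
    simpa using ((hasDerivAt_id (0 : ℂ)).smul_const (Pi.single l 1 : Fin n → ℂ)).const_add z
  have h2 : HasDerivAt (fun t : ℂ => f (z + t • (Pi.single l 1 : Fin n → ℂ))) (grad f z l) 0 := by
    refine HasFDerivAt.comp_hasDerivAt (f := fun t : ℂ => z + t • (Pi.single l 1 : Fin n → ℂ))
      (0 : ℂ) ?_ h1
    simpa using hfz.differentiableAt.hasFDerivAt
  have h3 : (fun t : ℂ => f (z + t • (Pi.single l 1 : Fin n → ℂ))) =ᶠ[𝓝 0] fun _ => 0 := by
    have h4 : Filter.Tendsto (fun t : ℂ => z + t • (Pi.single l 1 : Fin n → ℂ)) (𝓝 0) (𝓝 z) := by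
      simpa using h1.continuousAt.tendsto
    filter_upwards [h4.eventually hz] with t ht
    exact ht (by simp [hzj, hl.symm])
  exact h2.unique ((hasDerivAt_const 0 0).congr_of_eventuallyEq h3)

end Taylor

theorem indexCount_snoc {m n : ℕ} (i j l : Fin n) :
    indexCount (Fin.snoc (fun _ : Fin m => i) j : Fin (m + 1) → Fin n) l =
      (if i = l then m else 0) + if j = l then 1 else 0 := by
  rw [indexCount, Fintype.card_subtype, Finset.card_filter, Fin.sum_univ_castSucc]
  simp

/-! ### Exponents forced by an isolated singularity. -/

namespace IsIsolatedSingularity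

variable {f : (Fin 3 → ℂ) → ℂ}

theorem exists_taylorCoeff_near_axis (hf : IsIsolatedSingularity f) (i : Fin 3) :
    ∃ ν, taylorCoeff f ν ≠ 0 ∧ ∃ j, j ≠ i ∧ ν j ≤ 1 ∧ ∀ l, l ≠ i → l ≠ j → ν l = 0 := by
  by_contra! h
  have h1 := eventually_grad_eq_zero_on_axis hf.analyticAt i (by
    intro m j
    by_contra hne
    -- The exponent `m eᵢ + eⱼ` is near the axis through `j' = j` when `j ≠ i`, and through any `j'
    -- ≠ i` when `j = i`.
    obtain ⟨j', hj', hj⟩ : ∃ j', j' ≠ i ∧ (j = i ∨ j = j') := by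
      clear h hne; revert i j; decide
    obtain ⟨l, hli, hlj, hl⟩ := h _ hne j' hj' (by
      rw [indexCount_snoc, if_neg hj'.symm]; split_ifs <;> simp)
    refine hl ?_
    rw [indexCount_snoc, if_neg hli.symm, if_neg]
    rcases hj with rfl | rfl
    · exact hli.symm
    · exact hlj.symm)
  have h2 : Filter.Tendsto (fun t => (Pi.single i t : Fin 3 → ℂ)) (𝓝[≠] 0) (𝓝[≠] 0) := by
    refine tendsto_nhdsWithin_iff.2 ⟨?_, ?_⟩
    · have : Continuous (fun t => (Pi.single i t : Fin 3 → ℂ)) :=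
      continuous_single (A := fun _ => ℂ) i
      simpa using (this.tendsto 0).mono_left nhdsWithin_le_nhds
    · filter_upwards [self_mem_nhdsWithin] with t ht
      simpa using ht
  obtain ⟨t, ht1, ht2⟩ :=
    ((h2.eventually hf.isolated).and (h1.filter_mono nhdsWithin_le_nhds)).exists
  exact ht1 ht2

/-- Otherwise `f` vanishes on `z j = 0`, so there only the `j`-th partial derivative can be nonzero.
It vanishes at the origin, and as a function of two variables has zeros arbitrarily near, which are
critical points of `f`. -/
theorem exists_taylorCoeff_on_hyperplane (hf : IsIsolatedSingularity f) (j : Fin 3) :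
    ∃ ν, taylorCoeff f ν ≠ 0 ∧ ν j = 0 := by
  by_contra! h
  have h1 := eventually_grad_apply_eq_zero_on_hyperplane hf.analyticAt
    (eventually_eq_zero_on_hyperplane hf.analyticAt j fun ν hν => by_contra fun hne => h ν hne hν)
  obtain ⟨i, l, hij, hil, hjl⟩ : ∃ i l, i ≠ j ∧ i ≠ l ∧ j ≠ l := by
    clear h h1; revert j; decide
  let ι : ℂ × ℂ →L[ℂ] (Fin 3 → ℂ) :=
    (ContinuousLinearMap.fst ℂ ℂ ℂ).smulRight (Pi.single i 1) +
      (ContinuousLinearMap.snd ℂ ℂ ℂ).smulRight (Pi.single l 1)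
  have hι : ∀ p, ι p = p.1 • Pi.single i 1 + p.2 • Pi.single l 1 := fun p => rfl
  have hιj : ∀ p, ι p j = 0 := fun p => by simp [hι, hij.symm, hjl]
  have hιne : ∀ p, p ≠ 0 → ι p ≠ 0 := fun p hp h0 => hp <| Prod.ext
    (by simpa [hι, hil] using congrFun h0 i) (by simpa [hι, hil.symm] using congrFun h0 l)
  have h2 : Filter.Tendsto ι (𝓝 0) (𝓝 0) := by simpa using ι.continuous.tendsto 0
  have h3 : Filter.Tendsto ι (𝓝[≠] 0) (𝓝[≠] 0) := by
    refine tendsto_nhdsWithin_iff.2 ⟨h2.mono_left nhdsWithin_le_nhds, ?_⟩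
    filter_upwards [self_mem_nhdsWithin] with p hp
    exact hιne p hp
  have hG : AnalyticAt ℂ (fun p => grad f (ι p) j) 0 := by
    refine AnalyticAt.fun_comp (g := fun z => fderiv ℂ f z (Pi.single j 1)) (f := ι) ?_
      (ι.analyticAt 0)
    rw [ι.map_zero]
    exact analyticAt_fderiv_apply hf.analyticAt _
  have hG0 : grad f (ι 0) j = 0 := by rw [ι.map_zero, hf.grad_zero]; rfl
  obtain ⟨p, hp0, hp1, hp2⟩ := ((exists_zero_ne_of_analyticAt hG hG0).and_eventually
    ((h3.eventually hf.isolated).and ((h2.eventually h1).filter_mono nhdsWithin_le_nhds))).exists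
  refine hp1 (funext fun m => ?_)
  rcases eq_or_ne m j with rfl | hm
  · exact hp0
  · exact hp2 (hιj p) m hm

end IsIsolatedSingularity

/-! ### Level sets of linear forms on convex hulls. -/

section ConvexLevel

variable {E : Type*} [AddCommGroup E] [Module ℝ E]

/-- The points with the claimed property form a convex set containing `X`: a proper convex
combination reaches the lower bound `c` only if both endpoints do. -/
theorem mem_convexHull_level (L : E →ₗ[ℝ] ℝ) {X : Set E} {c : ℝ} (h : ∀ x ∈ X, c ≤ L x) {x : E}
    (hx : x ∈ convexHull ℝ X) : c ≤ L x ∧ (L x = c → x ∈ convexHull ℝ {y ∈ X | L y = c}) := by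
  have hconv : Convex ℝ {x | c ≤ L x ∧ (L x = c → x ∈ convexHull ℝ {y ∈ X | L y = c})} := by
    rintro x ⟨hx, hx'⟩ y ⟨hy, hy'⟩ a b ha hb hab
    have h1 : L (a • x + b • y) = a * L x + b * L y := by simp
    have h2 : c = a * c + b * c := by rw [← add_mul, hab, one_mul]
    have h3 := mul_le_mul_of_nonneg_left hx ha
    have h4 := mul_le_mul_of_nonneg_left hy hb
    refine ⟨by rw [h1]; linarith, fun h5 => ?_⟩
    rw [h1] at h5
    rcases ha.eq_or_lt with rfl | ha'
    · obtain rfl : b = 1 := by linarith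
      simpa using hy' (by linarith)
    rcases hb.eq_or_lt with rfl | hb'
    · obtain rfl : a = 1 := by linarith
      simpa using hx' (by linarith)
    exact convex_convexHull ℝ _ (hx' (mul_left_cancel₀ ha'.ne' (by linarith)))
      (hy' (mul_left_cancel₀ hb'.ne' (by linarith))) ha hb hab
  refine convexHull_min ?_ hconv hx
  exact fun x hx => ⟨h x hx, fun h1 => subset_convexHull ℝ _ ⟨hx, h1⟩⟩

theorem convexHull_level (L : E →ₗ[ℝ] ℝ) {X : Set E} {c : ℝ} (h : ∀ x ∈ X, c ≤ L x) :
    {x ∈ convexHull ℝ X | L x = c} = convexHull ℝ {y ∈ X | L y = c} := by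
  refine Set.Subset.antisymm (fun x hx => (mem_convexHull_level L h hx.1).2 hx.2) ?_
  refine convexHull_min (fun x hx => ⟨subset_convexHull ℝ _ hx.1, hx.2⟩) ?_
  exact (convex_convexHull ℝ X).inter (convex_hyperplane L.isLinear c)

theorem isExtreme_level (L : E →ₗ[ℝ] ℝ) {S : Set E} {c : ℝ} (h : ∀ x ∈ S, c ≤ L x) :
    IsExtreme ℝ S {x ∈ S | L x = c} := by
  refine ⟨fun x hx => hx.1, ?_⟩
  rintro x hx y hy z ⟨-, hz⟩ ⟨a, b, ha, hb, hab, rfl⟩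
  refine ⟨hx, ?_⟩
  have h1 : L (a • x + b • y) = a * L x + b * L y := by simp
  rw [h1] at hz
  have h2 : c = a * c + b * c := by rw [← add_mul, hab, one_mul]
  have h3 := mul_le_mul_of_nonneg_left (h x hx) ha.le
  have h4 := mul_le_mul_of_nonneg_left (h y hy) hb.le
  exact mul_left_cancel₀ ha.ne' (by linarith)

theorem vectorSpan_convexHull (s : Set E) : vectorSpan ℝ (convexHull ℝ s) = vectorSpan ℝ s := by
  rw [← direction_affineSpan, affineSpan_convexHull, direction_affineSpan]

theorem vectorSpan_le_ker (L : E →ₗ[ℝ] ℝ) {s : Set E} {c : ℝ} (h : ∀ x ∈ s, L x = c) :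
    vectorSpan ℝ s ≤ LinearMap.ker L := by
  refine Submodule.span_le.2 ?_
  rintro _ ⟨x, hx, y, hy, rfl⟩
  simp [h x hx, h y hy]

theorem finrank_lt_of_le_ker [FiniteDimensional ℝ E] (L : E →ₗ[ℝ] ℝ) {D D' : Submodule ℝ E}
    (hD : D ≤ D') (hL : D ≤ LinearMap.ker L) {w : E} (hw : w ∈ D') (hLw : L w ≠ 0) :
    Module.finrank ℝ D < Module.finrank ℝ D' :=
  Submodule.finrank_lt_finrank_of_lt <| lt_of_le_of_ne hD fun h => hLw (hL (h ▸ hw))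

end ConvexLevel

/-! ### Compact faces of the Newton polyhedron and their lattice points. -/

section NewtonPolyhedron

variable {n : ℕ}

/-- The lattice point `ν`, as a point of Euclidean space. -/
noncomputable def latticePoint (ν : Fin n → ℕ) : EuclideanSpace ℝ (Fin n) :=
  WithLp.toLp 2 fun i => (ν i : ℝ)

@[simp]
theorem latticePoint_apply (ν : Fin n → ℕ) (i : Fin n) : latticePoint ν i = ν i := rfl

theorem latticePoint_injective : Function.Injective (latticePoint (n := n)) := fun μ ν h =>
  funext fun i => by
    have := congrArg (fun x : EuclideanSpace ℝ (Fin n) => x i) h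
    simpa using this

/-- The linear form `⟨u, ·⟩`. -/
noncomputable def weightForm (u : EuclideanSpace ℝ (Fin n)) : EuclideanSpace ℝ (Fin n) →ₗ[ℝ] ℝ :=
  innerₗ _ u

theorem weightForm_eq_inner (u x : EuclideanSpace ℝ (Fin n)) : weightForm u x = inner ℝ u x := rfl

theorem weightForm_apply (u x : EuclideanSpace ℝ (Fin n)) : weightForm u x = ∑ i, u i * x i := by
  simp [weightForm_eq_inner, PiLp.inner_apply, mul_comm]

theorem weightForm_latticePoint (u : EuclideanSpace ℝ (Fin n)) (ν : Fin n → ℕ) :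
    weightForm u (latticePoint ν) = latticeWeight u.ofLp ν := by
  simp [weightForm_apply, latticeWeight]

/-- The `j`-th coordinate. -/
noncomputable def coordForm (j : Fin n) : EuclideanSpace ℝ (Fin n) →ₗ[ℝ] ℝ :=
  weightForm (EuclideanSpace.single j 1)

@[simp]
theorem coordForm_apply (j : Fin n) (x : EuclideanSpace ℝ (Fin n)) : coordForm j x = x j := by
  simp [coordForm, weightForm_apply]

/-- The set whose convex hull is the Newton polyhedron of `A`. -/
def latticeUpperSet (A : Set (Fin n → ℕ)) : Set (EuclideanSpace ℝ (Fin n)) :=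
  {x | ∃ ν ∈ A, ∀ i, (ν i : ℝ) ≤ x i}

/-- The lattice points of `F` where the form `u` takes the value `c`. -/
def activePoints (F : Set (Fin n → ℕ)) (u : EuclideanSpace ℝ (Fin n)) (c : ℝ) :
    Set (Fin n → ℕ) :=
  {ν ∈ F | latticeWeight u.ofLp ν = c}

theorem latticePoint_mem_latticeUpperSet {A : Set (Fin n → ℕ)} {ν : Fin n → ℕ} (hν : ν ∈ A) :
    latticePoint ν ∈ latticeUpperSet A :=
  ⟨ν, hν, fun _ => le_rfl⟩

theorem latticeWeight_le_weightForm {u x : EuclideanSpace ℝ (Fin n)} (hu : ∀ i, 0 ≤ u i)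
    {ν : Fin n → ℕ} (h : ∀ i, (ν i : ℝ) ≤ x i) : latticeWeight u.ofLp ν ≤ weightForm u x := by
  rw [weightForm_apply]
  exact Finset.sum_le_sum fun i _ => mul_le_mul_of_nonneg_left (h i) (hu i)

/-- For strictly positive `u`, moving up from a lattice point in any coordinate increases the form,
so the minimum is taken only at lattice points. -/
theorem level_latticeUpperSet {F : Set (Fin n → ℕ)} {u : EuclideanSpace ℝ (Fin n)}
    (hu : ∀ i, 0 < u i) {c : ℝ} (hc : ∀ ν ∈ F, c ≤ latticeWeight u.ofLp ν) :
    {x ∈ latticeUpperSet F | weightForm u x = c} = latticePoint '' activePoints F u c := by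
  ext x
  constructor
  · rintro ⟨⟨ν, hν, hνx⟩, hx⟩
    have h1 := latticeWeight_le_weightForm (fun i => (hu i).le) hνx
    have h2 : latticeWeight u.ofLp ν = c := le_antisymm (h1.trans hx.le) (hc ν hν)
    refine ⟨ν, ⟨hν, h2⟩, ?_⟩
    have h3 : ∑ i, u i * (x i - ν i) = 0 := by
      simp only [mul_sub, Finset.sum_sub_distrib]
      rw [← weightForm_apply, hx, ← h2, latticeWeight, sub_self]
    rw [Finset.sum_eq_zero_iff_of_nonneg
      fun i _ => mul_nonneg (hu i).le (sub_nonneg.2 (hνx i))] at h3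
    ext i
    have h4 := (mul_eq_zero.1 (h3 i (Finset.mem_univ i))).resolve_left (hu i).ne'
    simp only [latticePoint_apply]
    linarith
  · rintro ⟨ν, ⟨hν, h⟩, rfl⟩
    exact ⟨latticePoint_mem_latticeUpperSet hν, by rw [weightForm_latticePoint, h]⟩

theorem add_single_mem_convexHull_latticeUpperSet {F : Set (Fin n → ℕ)}
    {x : EuclideanSpace ℝ (Fin n)} (hx : x ∈ convexHull ℝ (latticeUpperSet F)) (i : Fin n) {t : ℝ}
    (ht : 0 ≤ t) : x + EuclideanSpace.single i t ∈ convexHull ℝ (latticeUpperSet F) := by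
  have h1 : Convex ℝ
      ((fun x => x + EuclideanSpace.single i t) ⁻¹' convexHull ℝ (latticeUpperSet F)) :=
    (convex_convexHull ℝ _).translate_preimage_left _
  refine convexHull_min ?_ h1 hx
  rintro y ⟨ν, hν, hy⟩
  refine subset_convexHull ℝ _ ⟨ν, hν, fun j => (hy j).trans ?_⟩
  rcases eq_or_ne j i with rfl | h <;> simp [*]

/-- A nonempty face is compact exactly when its weight is strictly positive: if `u i = 0` the face
is invariant under moving in the direction `eᵢ`. The condition `k ≠ 0` excludes the empty face,
whose span has dimension `0`. -/
theorem mem_compactFaces_iff [NeZero n] {f : (Fin n → ℂ) → ℂ} {F : Set (Fin n → ℕ)}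
    (hfin : F.Finite) (hF : newtonDiagram f = convexHull ℝ (latticeUpperSet F)) {k : ℕ}
    (hk : k ≠ 0) {S : Set (EuclideanSpace ℝ (Fin n))} :
    S ∈ compactFaces f k ↔ (∃ u : EuclideanSpace ℝ (Fin n), (∀ i, 0 < u i) ∧ ∃ c,
      (∀ ν ∈ F, c ≤ latticeWeight u.ofLp ν) ∧
        S = convexHull ℝ (latticePoint '' activePoints F u c)) ∧
      Module.finrank ℝ (vectorSpan ℝ S) = k := by
  have hSne : Module.finrank ℝ (vectorSpan ℝ S) = k → S.Nonempty := fun h =>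
    Set.nonempty_iff_ne_empty.2 fun h0 => hk (by
      rw [← h, h0, vectorSpan_empty, finrank_bot])
  refine ⟨?_, ?_⟩
  · rintro ⟨⟨hcomp, u, hu0, -, rfl⟩, hdim⟩
    obtain ⟨x, hx, hxc⟩ := hSne hdim
    rw [hF] at hx hxc
    have hlow : ∀ y ∈ convexHull ℝ (latticeUpperSet F),
        supportValue u (convexHull ℝ (latticeUpperSet F)) ≤ weightForm u y := by
      refine fun y hy => csInf_le ⟨0, ?_⟩ ⟨y, hy, rfl⟩
      rintro _ ⟨z, hz, rfl⟩
      refine (mem_convexHull_level (weightForm u) (c := 0) ?_ hz).1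
      rintro w ⟨ν, -, hw⟩
      exact le_trans (Finset.sum_nonneg fun i _ => mul_nonneg (hu0 i) (Nat.cast_nonneg _))
        (latticeWeight_le_weightForm hu0 hw)
    have hupos : ∀ i, 0 < u i := by
      refine fun i => (hu0 i).lt_of_ne fun hi => ?_
      obtain ⟨C, hC⟩ := hcomp.isBounded.exists_norm_le
      -- A shift by this amount pushes the `i`-th coordinate beyond the norm bound `C`.
      have h1 : 0 ≤ |C - x i| + 1 := by positivity
      have h2 := hC (x + EuclideanSpace.single i (|C - x i| + 1)) (by
        rw [hF]
        refine ⟨add_single_mem_convexHull_latticeUpperSet hx i h1, ?_⟩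
        rw [inner_add_right, hxc]
        simp [PiLp.inner_apply, ← hi])
      have h3 := (PiLp.norm_apply_le (x + EuclideanSpace.single i (|C - x i| + 1)) i).trans h2
      have h4 := (le_abs_self _).trans h3
      simp only [PiLp.add_apply, PiLp.single_apply, if_true] at h4
      linarith [le_abs_self (C - x i)]
    refine ⟨⟨u, hupos, supportValue u (newtonDiagram f), fun ν hν => ?_, ?_⟩, hdim⟩
    · rw [hF, ← weightForm_latticePoint]
      exact hlow _ (subset_convexHull ℝ _ (latticePoint_mem_latticeUpperSet hν))
    · rw [hF, ← level_latticeUpperSet hupos, ← convexHull_level]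
      · rfl
      · exact fun y hy => hlow y (subset_convexHull ℝ _ hy)
      · intro ν hν
        rw [← weightForm_latticePoint]
        exact hlow _ (subset_convexHull ℝ _ (latticePoint_mem_latticeUpperSet hν))
  · rintro ⟨⟨u, hu, c, hc, hS⟩, hdim⟩
    have hX : ∀ x ∈ latticeUpperSet F, c ≤ weightForm u x := by
      rintro x ⟨ν, hν, hx⟩
      exact (hc ν hν).trans (latticeWeight_le_weightForm (fun i => (hu i).le) hx)
    have hS' : S = {x ∈ convexHull ℝ (latticeUpperSet F) | weightForm u x = c} := by
      rw [hS, ← level_latticeUpperSet hu hc, convexHull_level _ hX]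
    have hval : supportValue u (newtonDiagram f) = c := by
      obtain ⟨x, hx⟩ := hSne hdim
      rw [hS'] at hx
      refine IsLeast.csInf_eq ⟨⟨x, hF ▸ hx.1, hx.2⟩, ?_⟩
      rintro _ ⟨y, hy, rfl⟩
      rw [hF] at hy
      exact (mem_convexHull_level _ hX hy).1
    refine ⟨⟨?_, u, fun i => (hu i).le, ?_, ?_⟩, hdim⟩
    · rw [hS]
      exact ((hfin.subset fun ν h => h.1).image _).isCompact_convexHull ℝ
    · rintro rfl
      exact (hu 0).ne' rfl
    · rw [supportFace, hval, hS', hF]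
      rfl

theorem infDist_coordAxis (x : EuclideanSpace ℝ (Fin n)) (i : Fin n) :
    Metric.infDist x (coordAxis i) = √(∑ j, if j = i then 0 else x j ^ 2) := by
  have hmem : EuclideanSpace.single i (x i) ∈ coordAxis i := fun j hj => by simp [hj]
  refine le_antisymm ((Metric.infDist_le_dist_of_mem hmem).trans_eq ?_)
    ((Metric.le_infDist ⟨_, hmem⟩).2 fun y hy => ?_)
  · rw [EuclideanSpace.dist_eq]
    congr 1
    refine Finset.sum_congr rfl fun j _ => ?_
    split_ifs with h
    · subst h; simp
    · simp [h]
  · rw [EuclideanSpace.dist_eq]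
    refine Real.sqrt_le_sqrt (Finset.sum_le_sum fun j _ => ?_)
    split_ifs with h
    · positivity
    · simp [hy j h]

/-- The squares of the coordinates off the axis are natural numbers with sum `1`. -/
theorem coord_of_infDist_coordAxis_eq_one {ω : Fin n → ℕ} {i j : Fin n}
    (h : Metric.infDist (latticePoint ω) (coordAxis i) = 1) (hji : j ≠ i) (hj : ω j ≠ 0) :
    ω j = 1 ∧ ∀ l, l ≠ i → l ≠ j → ω l = 0 := by
  rw [infDist_coordAxis, Real.sqrt_eq_one] at h
  have h1 : (∑ l, if l = i then 0 else ω l ^ 2) = 1 := by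
    have : ((∑ l, if l = i then 0 else ω l ^ 2 : ℕ) : ℝ) = 1 := by
      rw [← h]; push_cast; rfl
    exact_mod_cast this
  rw [← Finset.add_sum_erase _ _ (Finset.mem_univ j), if_neg hji] at h1
  have h2 : 1 ≤ ω j ^ 2 := Nat.one_le_iff_ne_zero.2 (pow_ne_zero 2 hj)
  have h3 : ω j ^ 2 = 1 := by omega
  have h4 : (∑ l ∈ Finset.univ.erase j, if l = i then 0 else ω l ^ 2) = 0 := by omega
  refine ⟨by simpa using h3, fun l hli hlj => ?_⟩
  rw [Finset.sum_eq_zero_iff] at h4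
  simpa [hli] using h4 l (by simp [hlj])

/-- The lattice points on an exceptional face, apart from its distinguished vertex, lie on a
coordinate hyperplane. -/
theorem IsExceptionalFace.exists_lattice {f : (Fin n → ℂ) → ℂ} {i : Fin n} {G : Set (Fin n → ℕ)}
    (hG : G.Finite) (hne : ∀ j, ∃ ν ∈ G, ν j ≠ 0)
    (h : IsExceptionalFace f i (convexHull ℝ (latticePoint '' G))) :
    ∃ j, i ≠ j ∧ ∃ ω ∈ G, ω j = 1 ∧ (∀ l, l ≠ i → l ≠ j → ω l = 0) ∧
      ∀ ν ∈ G, ν ≠ ω → ν j = 0 := by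
  obtain ⟨-, W, hW, hdist, T, -, hT, j, hji, hTj⟩ := h
  obtain ⟨ω, hω, rfl⟩ := extremePoints_convexHull_subset hW
  set S := convexHull ℝ (latticePoint '' G) with hS
  have hScomp : IsCompact S := (hG.image _).isCompact_convexHull ℝ
  have hext : convexHull ℝ (S.extremePoints ℝ) = S := by
    have hfin : (S.extremePoints ℝ).Finite :=
      (hG.image _).subset extremePoints_convexHull_subset
    rw [← (hfin.isClosed_convexHull ℝ).closure_eq]
    exact closure_convexHull_extremePoints hScomp (convex_convexHull ℝ _)
  have hX : ∀ x ∈ S.extremePoints ℝ, x = latticePoint ω ∨ x j = 0 := by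
    intro x hx
    refine or_iff_not_imp_left.2 fun hne => hTj ?_
    have h1 : x ∈ T.extremePoints ℝ := hT ▸ ⟨hx, hne⟩
    exact h1.1
  -- The definition controls only the vertices; since `S` is the hull of its vertices, the
  -- information passes to all lattice points of `G`.
  have hmem : ∀ ν ∈ G, latticePoint ν ∈ convexHull ℝ (S.extremePoints ℝ) := fun ν hν => by
    rw [hext]; exact subset_convexHull ℝ _ ⟨ν, hν, rfl⟩
  have hωj : ω j ≠ 0 := by
    intro h0
    obtain ⟨ν, hν, hνj⟩ := hne j
    refine hνj ?_
    have h1 := convexHull_min (s := S.extremePoints ℝ) (t := {x | coordForm j x = 0})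
      (fun x hx => by
        rcases hX x hx with rfl | h
        · simp [h0]
        · simpa using h) (convex_hyperplane (coordForm j).isLinear 0) (hmem ν hν)
    simpa using h1
  obtain ⟨h1, h2⟩ := coord_of_infDist_coordAxis_eq_one hdist hji hωj
  refine ⟨j, hji.symm, ω, hω, h1, h2, fun ν hν hνω => ?_⟩
  -- The `j`-th coordinate is at most `1` on the hull, with equality only at `ω`; a lattice point
  -- other than `ω` must therefore have it equal to `0`.
  have h3 := mem_convexHull_level (-coordForm j) (c := -1) (fun x hx => by
    rcases hX x hx with rfl | h
    · simp [h1]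
    · simp [h]) (hmem ν hν)
  have h4 : {x ∈ S.extremePoints ℝ | (-coordForm j) x = -1} ⊆ {latticePoint ω} := by
    rintro x ⟨hx, hx1⟩
    refine (hX x hx).resolve_right fun h => ?_
    simp [h] at hx1
  have h5 : ν j ≤ 1 := by
    have := h3.1
    simp only [LinearMap.neg_apply, coordForm_apply, latticePoint_apply, neg_le_neg_iff] at this
    exact_mod_cast this
  have h6 : ν j ≠ 1 := by
    intro h
    have h7 := convexHull_mono h4 (h3.2 (by simp [h]))
    rw [convexHull_singleton] at h7
    exact hνω (latticePoint_injective h7)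
  omega

/-- The direction space lies in the kernel of `u`, and together with one active point it spans
everything, since only zero annihilates all active points. -/
theorem finrank_vectorSpan_activePoints {m : ℕ} {F : Set (Fin (m + 1) → ℕ)}
    {u : EuclideanSpace ℝ (Fin (m + 1))} (hu : u ≠ 0) {c : ℝ}
    (h : ∀ v : Fin (m + 1) → ℝ, (∀ ν ∈ activePoints F u c, latticeWeight v ν = 0) → v = 0) :
    Module.finrank ℝ (vectorSpan ℝ (convexHull ℝ (latticePoint '' activePoints F u c))) = m := by
  rw [vectorSpan_convexHull]
  set s := latticePoint '' activePoints F u c with hs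
  set D := vectorSpan ℝ s
  have hdim : Module.finrank ℝ (EuclideanSpace ℝ (Fin (m + 1))) = m + 1 := by simp
  refine le_antisymm ?_ ?_
  · have h1 : D ≤ LinearMap.ker (weightForm u) := by
      refine vectorSpan_le_ker (weightForm u) (c := c) ?_
      rintro _ ⟨ν, hν, rfl⟩
      rw [weightForm_latticePoint, hν.2]
    have h2 : weightForm u ≠ 0 := fun h0 => hu (by
      have : weightForm u u = 0 := by rw [h0]; rfl
      rwa [weightForm_eq_inner, inner_self_eq_zero] at this)
    have h3 := Module.Dual.finrank_ker_add_one_of_ne_zero (f := weightForm u) h2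
    have h4 := Submodule.finrank_mono h1
    rw [hdim] at h3
    omega
  · obtain ⟨ν₀, hν₀⟩ : (activePoints F u c).Nonempty := by
      by_contra hne
      rw [Set.not_nonempty_iff_eq_empty] at hne
      have := congrFun (h 1 (by simp [hne])) 0
      simp at this
    have h1 : D ⊔ ℝ ∙ latticePoint ν₀ = ⊤ := by
      rw [← Submodule.orthogonal_eq_bot_iff, Submodule.eq_bot_iff]
      intro v hv
      have h2 := h v.ofLp fun ν hν => by
        rw [← weightForm_latticePoint, weightForm_eq_inner, real_inner_comm]
        refine (Submodule.mem_orthogonal _ v).1 hv _ ?_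
        have h3 : latticePoint ν = (latticePoint ν - latticePoint ν₀) + latticePoint ν₀ := by simp
        rw [h3]
        exact Submodule.add_mem_sup (vsub_mem_vectorSpan ℝ ⟨ν, hν, rfl⟩ ⟨ν₀, hν₀, rfl⟩)
          (Submodule.mem_span_singleton_self _)
      ext i
      exact congrFun h2 i
    have h2 := Submodule.finrank_add_le_finrank_add_finrank D (ℝ ∙ latticePoint ν₀)
    have h3 := finrank_span_le_card (R := ℝ) ({latticePoint ν₀} : Set (EuclideanSpace ℝ (Fin (m + 1))))
    rw [h1, finrank_top, hdim] at h2
    simp at h3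
    omega

theorem exists_coord_ne_zero_of_finrank {m : ℕ} {F : Set (Fin (m + 2) → ℕ)}
    {u : EuclideanSpace ℝ (Fin (m + 2))} (hu : ∀ i, 0 < u i) {c : ℝ}
    (hdim : Module.finrank ℝ
      (vectorSpan ℝ (convexHull ℝ (latticePoint '' activePoints F u c))) = m + 1)
    (j : Fin (m + 2)) : ∃ ν ∈ activePoints F u c, ν j ≠ 0 := by
  by_contra! h
  rw [vectorSpan_convexHull] at hdim
  obtain ⟨i, hij⟩ := exists_ne j
  have h1 : vectorSpan ℝ (latticePoint '' activePoints F u c) ≤ LinearMap.ker (weightForm u) := by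
    refine vectorSpan_le_ker (weightForm u) (c := c) ?_
    rintro _ ⟨ν, hν, rfl⟩
    rw [weightForm_latticePoint, hν.2]
  have h2 : vectorSpan ℝ (latticePoint '' activePoints F u c) ≤ LinearMap.ker (coordForm j) := by
    refine vectorSpan_le_ker (coordForm j) (c := 0) ?_
    rintro _ ⟨ν, hν, rfl⟩
    simp [h ν hν]
  -- The vector `(u i) eⱼ - (u j) eᵢ` is killed by `u` but not by the `j`-th coordinate, so a face
  -- inside `xⱼ = 0` would have too small a dimension.
  have h3 := finrank_lt_of_le_ker (coordForm j) h1 h2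
    (w := EuclideanSpace.single j (u i) - EuclideanSpace.single i (u j))
    (by rw [LinearMap.mem_ker, map_sub]; simp [weightForm_apply, mul_comm])
    (by simp [hij.symm, (hu i).ne'])
  have h4 : weightForm u ≠ 0 := fun h0 => (hu 0).ne' (by
    have : weightForm u (EuclideanSpace.single 0 1) = 0 := by rw [h0]; rfl
    simpa [weightForm_apply] using this)
  have h5 := Module.Dual.finrank_ker_add_one_of_ne_zero (f := weightForm u) h4
  rw [finrank_euclideanSpace_fin] at h5
  omega

end NewtonPolyhedron

/-! ### Special segments as hulls of lattice points. -/

theorem specialSegment_eq_convexHull {i j l : Fin 3} (hij : i ≠ j) (hil : i ≠ l) (hjl : j ≠ l)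
    (k : ℕ) : specialSegment l k = convexHull ℝ (latticePoint ''
      {Pi.single i 1 + Pi.single j 1, Pi.single l k}) := by
  rw [Set.image_pair, convexHull_pair, specialSegment]
  congr 1 <;> ext m
  · revert m
    exact Fin.forall_of_ne_three hij hil hjl (by simp [hij, hil]) (by simp [hij.symm, hjl])
      (by simp [hil.symm, hjl.symm])
  · rcases eq_or_ne m l with rfl | h <;> simp [*]

theorem single_add_single_ne_single {i j l : Fin 3} (hil : i ≠ l) (k : ℕ) :
    (Pi.single i 1 + Pi.single j 1 : Fin 3 → ℕ) ≠ Pi.single l k := fun h => by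
  simpa [hil] using congrFun h i

/-- The lattice points spanning a special segment are its endpoints. -/
theorem eq_pair_of_specialSegment_eq {i j l : Fin 3} (hij : i ≠ j) (hil : i ≠ l) (hjl : j ≠ l)
    {k : ℕ} {G : Set (Fin 3 → ℕ)} (h : specialSegment l k = convexHull ℝ (latticePoint '' G)) :
    G = {Pi.single i 1 + Pi.single j 1, Pi.single l k} := by
  have hseg := specialSegment_eq_convexHull hij hil hjl k
  have hsub : G ⊆ {Pi.single i 1 + Pi.single j 1, Pi.single l k} := by
    intro ν hν
    have h1 : latticePoint ν ∈ specialSegment l k := h ▸ subset_convexHull ℝ _ ⟨ν, hν, rfl⟩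
    rw [hseg, Set.image_pair, convexHull_pair] at h1
    obtain ⟨a, b, ha, hb, hab, h2⟩ := h1
    have h3 : ∀ m, a * ((Pi.single i 1 + Pi.single j 1 : Fin 3 → ℕ) m : ℝ) +
        b * ((Pi.single l k : Fin 3 → ℕ) m : ℝ) = ν m := fun m =>
      congrArg (fun x : EuclideanSpace ℝ (Fin 3) => x m) h2
    -- The coefficient `a` is a natural number between `0` and `1`, so `ν` is an endpoint.
    have hi : a = ν i := by simpa [hij, hil] using h3 i
    have hj : a = ν j := by simpa [hij, hjl] using h3 j
    have hl : b * k = ν l := by simpa [hil.symm, hjl.symm] using h3 l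
    have hi1 : ν i ≤ 1 := by exact_mod_cast (by linarith : (ν i : ℝ) ≤ 1)
    have hji : ν j = ν i := by exact_mod_cast hj.symm.trans hi
    rcases Nat.le_one_iff_eq_zero_or_eq_one.1 hi1 with h0 | h0
    · right
      rw [h0, Nat.cast_zero] at hi
      have hb1 : b = 1 := by linarith
      rw [hb1, one_mul] at hl
      have hl' : k = ν l := by exact_mod_cast hl
      rw [hl']
      exact eq_single_of_ne hij hil hjl h0 (hji.trans h0)
    · left
      rw [h0, Nat.cast_one] at hi
      have hb1 : b = 0 := by linarith
      rw [hb1, zero_mul] at hl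
      exact eq_single_add_single hij hil hjl h0 (hji.trans h0) (by exact_mod_cast hl.symm)
  -- If `G` had at most one point, its hull could not contain two distinct endpoints.
  have hmem : ∀ μ ∈ ({Pi.single i 1 + Pi.single j 1, Pi.single l k} : Set (Fin 3 → ℕ)),
      ∀ μ', G ⊆ {μ'} → μ = μ' := by
    intro μ hμ μ' hG
    have h1 : latticePoint μ ∈ convexHull ℝ (latticePoint '' G) := by
      rw [← h, hseg]; exact subset_convexHull ℝ _ ⟨μ, hμ, rfl⟩
    have h2 := convexHull_mono (Set.image_mono hG) h1
    rw [Set.image_singleton, convexHull_singleton] at h2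
    exact latticePoint_injective h2
  have hne := single_add_single_ne_single (j := j) hil k
  refine hsub.antisymm ?_
  rintro ν (rfl | rfl)
  · by_contra hν
    refine hne (hmem _ (Or.inl rfl) _ fun μ hμ => (hsub hμ).resolve_left ?_)
    rintro rfl
    exact hν hμ
  · by_contra hν
    refine hne.symm (hmem _ (Or.inr rfl) _ fun μ hμ => (hsub hμ).resolve_right ?_)
    rintro rfl
    exact hν hμ

theorem finrank_vectorSpan_pair {E : Type*} [AddCommGroup E] [Module ℝ E] {x y : E} (h : x ≠ y) :
    Module.finrank ℝ (vectorSpan ℝ {x, y}) = 1 := by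
  rw [vectorSpan_pair]
  exact finrank_span_singleton (sub_ne_zero.2 h)

theorem compactFaces_inter_specialSegments_nonempty {f : (Fin 3 → ℂ) → ℂ} {F : Set (Fin 3 → ℕ)}
    (hfin : F.Finite) (hF : newtonDiagram f = convexHull ℝ (latticeUpperSet F))
    (h : HasSpecialEdge F) : (compactFaces f 1 ∩ specialSegments).Nonempty := by
  obtain ⟨i, j, l, hij, hil, hjl, k, hk, u, hu, hu1, hact⟩ := h
  refine ⟨specialSegment l k, (mem_compactFaces_iff hfin hF one_ne_zero).2
    ⟨⟨WithLp.toLp 2 u, hu, 1, hu1, ?_⟩, ?_⟩, l, k, hk, rfl⟩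
  · rw [specialSegment_eq_convexHull hij hil hjl, ← hact]
    rfl
  · rw [specialSegment_eq_convexHull hij hil hjl, vectorSpan_convexHull, Set.image_pair]
    exact finrank_vectorSpan_pair fun h =>
      single_add_single_ne_single hil k (latticePoint_injective h)

/-! ### A special edge makes every compact 2-face exceptional. -/

theorem eq_of_le_of_latticeWeight_le {n : ℕ} {w : Fin n → ℝ} (hw : ∀ i, 0 < w i)
    {μ ν : Fin n → ℕ} (h : μ ≤ ν) (hle : latticeWeight w ν ≤ latticeWeight w μ) : ν = μ := by
  by_contra hne
  obtain ⟨i, hi⟩ := (Pi.lt_def.1 (lt_of_le_of_ne h (Ne.symm hne))).2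
  refine hle.not_gt (Finset.sum_lt_sum (fun m _ => mul_le_mul_of_nonneg_left
    (by exact_mod_cast h m) (hw m).le) ⟨i, Finset.mem_univ i, ?_⟩)
  exact mul_lt_mul_of_pos_left (by exact_mod_cast hi) (hw i)

/-- If `[eᵢ + eⱼ, k eₗ]` is an edge, the other lattice points on a compact face lie in one of the
two coordinate planes that contain the axis `OXₗ`. -/
theorem forall_active_of_special_edge {F : Set (Fin 3 → ℕ)} {i j l : Fin 3} (hij : i ≠ j)
    (hil : i ≠ l) (hjl : j ≠ l) {k : ℕ} (hk : k ≠ 0) {u : Fin 3 → ℝ} (hu : ∀ i, 0 < u i) {c : ℝ}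
    (huF : ∀ ν ∈ F, c ≤ latticeWeight u ν)
    (hact : {ν ∈ F | latticeWeight u ν = c} = {Pi.single i 1 + Pi.single j 1, Pi.single l k})
    {w : Fin 3 → ℝ} (hw : ∀ i, 0 < w i) {d : ℝ} (hwF : ∀ ν ∈ F, d ≤ latticeWeight w ν) :
    (∀ ν ∈ F, latticeWeight w ν = d → ν ≠ Pi.single i 1 + Pi.single j 1 → ν j = 0) ∨
      ∀ ν ∈ F, latticeWeight w ν = d → ν ≠ Pi.single i 1 + Pi.single j 1 → ν i = 0 := by
  have hω : Pi.single i 1 + Pi.single j 1 ∈ {ν ∈ F | latticeWeight u ν = c} := by simp [hact]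
  have hκ : Pi.single l k ∈ {ν ∈ F | latticeWeight u ν = c} := by simp [hact]
  by_contra! hcon
  obtain ⟨⟨ν, hν, hνd, hνω, hνj⟩, μ, hμ, hμd, hμω, hμi⟩ := hcon
  -- A point with both coordinates nonzero dominates `eᵢ + eⱼ`, hence has larger weight unless equal
  -- to it.
  have hplane : ∀ ν ∈ F, latticeWeight w ν = d → ν ≠ Pi.single i 1 + Pi.single j 1 →
      ν i = 0 ∨ ν j = 0 := by
    intro ν hν hνd hνω
    by_contra! h
    refine hνω (eq_of_le_of_latticeWeight_le hw (fun m => ?_) (hνd.trans_le (hwF _ hω.1)))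
    revert m
    exact Fin.forall_of_ne_three hij hil hjl
      (by simpa [hij] using Nat.one_le_iff_ne_zero.2 h.1)
      (by simpa [hij.symm] using Nat.one_le_iff_ne_zero.2 h.2) (by simp [hil.symm, hjl.symm])
  have hνi := (hplane ν hν hνd hνω).resolve_right hνj
  have hμj := (hplane μ hμ hμd hμω).resolve_left hμi
  have hstrict : ∀ ν ∈ F, ν ≠ Pi.single i 1 + Pi.single j 1 → ν ≠ Pi.single l k →
      c < latticeWeight u ν := fun ν hν h1 h2 => (huF ν hν).lt_of_ne fun h3 => by
    have h4 : ν ∈ {ν ∈ F | latticeWeight u ν = c} := ⟨hν, h3.symm⟩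
    rw [hact] at h4
    exact h4.elim h1 h2
  have e1 := hstrict ν hν hνω (by rintro rfl; simp [hjl] at hνj)
  have e2 := hstrict μ hμ hμω (by rintro rfl; simp [hil] at hμi)
  have e3 := hω.2
  have e4 := hκ.2
  have e5 := hwF _ hω.1
  have e6 := hwF _ hκ.1
  simp only [latticeWeight_eq_of_ne hij hil hjl] at e1 e2 e3 e4 e5 e6 hνd hμd
  simp [hij, hij.symm, hil, hil.symm, hjl, hjl.symm, hνi, hμj] at e1 e2 e3 e4 e5 e6 hνd hμd
  have hb : (0 : ℝ) < ν j := by exact_mod_cast Nat.pos_of_ne_zero hνj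
  have ha : (0 : ℝ) < μ i := by exact_mod_cast Nat.pos_of_ne_zero hμi
  have hk' : (0 : ℝ) < k := by exact_mod_cast Nat.pos_of_ne_zero hk
  have hc : 0 < c := e4 ▸ mul_pos (hu l) hk'
  have hd : 0 < d := by
    have := mul_pos (hw j) hb
    have := mul_nonneg (hw l).le (Nat.cast_nonneg (α := ℝ) (ν l))
    linarith
  generalize (ν j : ℝ) = b at *
  generalize (μ i : ℝ) = a at *
  have hy : (0 : ℝ) ≤ ν l := Nat.cast_nonneg _
  have hx : (0 : ℝ) ≤ μ l := Nat.cast_nonneg _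
  generalize (ν l : ℝ) = y at *
  generalize (μ l : ℝ) = x at *
  generalize (k : ℝ) = K at *
  -- With `ν = b eⱼ + y eₗ` and `μ = a eᵢ + x eₗ`, the point `P = (a ν + b μ) / (a + b)` lies in the
  -- plane `xᵢ = xⱼ`, and `P = s (eᵢ + eⱼ) + t (K eₗ)` with `s + t = (a b K + a y + b x) / (K (a +
  -- b))`. The weight `u`, equal to `c` at both ends of the edge, gives `s + t > 1`; the weight `w`,
  -- equal to `d` at `P` and at least `d` at both ends, gives `s + t ≤ 1`.
  have hQ : 0 ≤ a * y + b * x := by positivity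
  have h1 : c * (K * (a + b)) < c * (a * b * K + (a * y + b * x)) := by
    have f1 := mul_lt_mul_of_pos_left e1 (mul_pos hk' ha)
    have f2 := mul_lt_mul_of_pos_left e2 (mul_pos hk' hb)
    have f3 : c * (a * b * K + (a * y + b * x)) =
        K * a * (u j * b + u l * y) + K * b * (u i * a + u l * x) := by
      linear_combination (-(a * b * K)) * e3 - (a * y + b * x) * e4
    rw [f3]
    linarith
  have h2 : d * (a * b * K + (a * y + b * x)) ≤ d * (K * (a + b)) := by
    have f1 := mul_le_mul_of_nonneg_left e5 (mul_pos (mul_pos ha hb) hk').le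
    have f2 := mul_le_mul_of_nonneg_left e6 hQ
    have f3 : d * (K * (a + b)) = a * b * K * (w i + w j) + (a * y + b * x) * (w l * K) := by
      linear_combination (-(K * a)) * hνd - (K * b) * hμd
    rw [f3]
    linarith
  exact (lt_of_mul_lt_mul_left h1 hc.le).not_ge (le_of_mul_le_mul_left h2 hd)

/-- The apex `eᵢ + eⱼ` is the only point of the face at height `1` in the `j`-th coordinate, all
other generators being at height `0`. The slice at height `0` is then the required edge. -/
theorem isExceptionalFace_of_forall {f : (Fin 3 → ℂ) → ℂ} {F : Set (Fin 3 → ℕ)}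
    (hfin : F.Finite) (hF : newtonDiagram f = convexHull ℝ (latticeUpperSet F)) {i j l : Fin 3}
    (hij : i ≠ j) (hil : i ≠ l) (hjl : j ≠ l) {w : EuclideanSpace ℝ (Fin 3)} (hw : ∀ i, 0 < w i)
    {d : ℝ} (hwF : ∀ ν ∈ F, d ≤ latticeWeight w.ofLp ν)
    (hS : convexHull ℝ (latticePoint '' activePoints F w d) ∈ compactFaces f 2)
    (h : ∀ ν ∈ activePoints F w d, ν ≠ Pi.single i 1 + Pi.single j 1 → ν j = 0) :
    IsExceptionalFace f i (convexHull ℝ (latticePoint '' activePoints F w d)) := by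
  have hdim := hS.2
  have hX : ∀ x ∈ latticePoint '' activePoints F w d,
      x = latticePoint (Pi.single i 1 + Pi.single j 1) ∨ x j = 0 := by
    rintro _ ⟨ν, hν, rfl⟩
    refine (em (ν = Pi.single i 1 + Pi.single j 1)).imp (fun h => by rw [h]) fun hne => ?_
    simp [h ν hν hne]
  set ω : Fin 3 → ℕ := Pi.single i 1 + Pi.single j 1 with hω
  have hωj : ω j = 1 := by simp [hω, hij.symm]
  have hωmem : ω ∈ activePoints F w d := by
    obtain ⟨ν, hν, hνj⟩ := exists_coord_ne_zero_of_finrank hw hdim j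
    exact not_imp_comm.1 (h ν hν) hνj ▸ hν
  set S := convexHull ℝ (latticePoint '' activePoints F w d) with hSdef
  have hWS : latticePoint ω ∈ S := subset_convexHull ℝ _ ⟨ω, hωmem, rfl⟩
  have htop : ∀ x ∈ latticePoint '' activePoints F w d, -1 ≤ (-coordForm j) x := by
    intro x hx
    rcases hX x hx with rfl | h0
    · simp [hωj]
    · simp [h0]
  have hbot : ∀ x ∈ latticePoint '' activePoints F w d, 0 ≤ coordForm j x := by
    rintro _ ⟨ν, -, rfl⟩
    simp
  have hWlevel : {x ∈ S | (-coordForm j) x = -1} = {latticePoint ω} := by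
    refine Set.Subset.antisymm ?_ (Set.singleton_subset_iff.2 ⟨hWS, by simp [hωj]⟩)
    rw [convexHull_level _ htop]
    refine (convexHull_mono (t := {latticePoint ω}) ?_).trans (convexHull_singleton _).subset
    rintro x ⟨hx, hx1⟩
    refine (hX x hx).resolve_right fun h0 => ?_
    simp [h0] at hx1
  have hWext : latticePoint ω ∈ S.extremePoints ℝ := by
    rw [← isExtreme_singleton, ← hWlevel]
    exact isExtreme_level _ fun x hx => (mem_convexHull_level _ htop hx).1
  have hText := isExtreme_level (S := S) (coordForm j) (c := 0) fun x hx =>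
    (mem_convexHull_level _ hbot hx).1
  -- Adding `eⱼ` to the weight penalizes exactly the points with positive `j`-th coordinate, so the
  -- slice is itself a compact face.
  have hTeq : {x ∈ S | coordForm j x = 0} = convexHull ℝ (latticePoint ''
      activePoints F (w + EuclideanSpace.single j 1) d) := by
    rw [convexHull_level _ hbot]
    congr 1
    have hsum : ∀ ν, latticeWeight (w + EuclideanSpace.single j (1 : ℝ)).ofLp ν =
        latticeWeight w.ofLp ν + ν j := by
      intro ν
      rw [← weightForm_latticePoint, ← weightForm_latticePoint]
      simp [weightForm_apply, add_mul, Finset.sum_add_distrib]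
    ext x
    constructor
    · rintro ⟨⟨ν, hν, rfl⟩, h0⟩
      have h1 : (ν j : ℝ) = 0 := by simpa using h0
      exact ⟨ν, ⟨hν.1, by rw [hsum, hν.2, h1, add_zero]⟩, rfl⟩
    · rintro ⟨ν, ⟨hν, hνd⟩, rfl⟩
      rw [hsum] at hνd
      have h1 := hwF ν hν
      have h2 : (0 : ℝ) ≤ ν j := Nat.cast_nonneg _
      exact ⟨⟨ν, ⟨hν, by linarith⟩, rfl⟩, by simpa using (by linarith : (ν j : ℝ) = 0)⟩
  set T := {x ∈ S | coordForm j x = 0} with hT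
  have hTsub : T ⊆ S := fun x hx => hx.1
  have hW1 : coordForm j (latticePoint ω) = 1 := by simp [hωj]
  obtain ⟨t, ht⟩ : T.Nonempty := by
    obtain ⟨ν, hν, hνi⟩ : ∃ ν ∈ activePoints F w d, ν j = 0 := by
      by_contra! hne
      have h1 : latticePoint '' activePoints F w d ⊆ {latticePoint ω} := by
        rintro _ ⟨ν, hν, rfl⟩
        exact congrArg _ (not_imp_comm.1 (h ν hν) (hne ν hν))
      have h2 := Submodule.finrank_mono (vectorSpan_mono ℝ h1)
      rw [vectorSpan_singleton, finrank_bot, ← vectorSpan_convexHull, ← hSdef, hdim] at h2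
      omega
    exact ⟨latticePoint ν, subset_convexHull ℝ _ ⟨ν, hν, rfl⟩, by simp [hνi]⟩
  -- The slice loses a dimension because the apex is off the plane, and only one because `S` is
  -- spanned by `T` and the single vector from `t` to the apex.
  have hTdim : Module.finrank ℝ (vectorSpan ℝ T) = 1 := by
    refine le_antisymm ?_ ?_
    · have h1 := finrank_lt_of_le_ker (coordForm j) (vectorSpan_mono ℝ hTsub)
        (vectorSpan_le_ker (coordForm j) (c := 0) fun x hx => hx.2)
        (vsub_mem_vectorSpan ℝ hWS ht.1) (by
          rw [vsub_eq_sub, map_sub, hW1, ht.2]; norm_num)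
      rw [hdim] at h1
      exact Nat.lt_succ_iff.1 h1
    · have h1 : vectorSpan ℝ S ≤ vectorSpan ℝ T ⊔ ℝ ∙ (latticePoint ω - t) := by
        have hW : latticePoint ω ∈ latticePoint '' activePoints F w d := ⟨ω, hωmem, rfl⟩
        rw [hSdef, vectorSpan_convexHull, vectorSpan_eq_span_vsub_set_right ℝ hW,
          Submodule.span_le]
        rintro _ ⟨x, hx, rfl⟩
        have h2 := Submodule.mem_span_singleton_self (R := ℝ) (latticePoint ω - t)
        rcases hX x hx with rfl | h0
        · simp
        · have h3 : x -ᵥ latticePoint ω = (x - t) + -(latticePoint ω - t) := by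
            rw [vsub_eq_sub]; abel
          beta_reduce
          rw [h3]
          exact Submodule.add_mem_sup (vsub_mem_vectorSpan ℝ
            ⟨subset_convexHull ℝ _ hx, by simpa using h0⟩ ht) (neg_mem h2)
      have h2 := Submodule.finrank_mono h1
      have h3 := Submodule.finrank_add_le_finrank_add_finrank (vectorSpan ℝ T)
        (ℝ ∙ (latticePoint ω - t))
      have h4 := finrank_span_le_card (R := ℝ) ({latticePoint ω - t} : Set (EuclideanSpace ℝ (Fin 3)))
      simp at h4
      omega
  refine ⟨hS, latticePoint ω, hWext, ?_, T, ?_, ?_, j, hij.symm, fun x hx =>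
    (coordForm_apply j x).symm.trans hx.2⟩
  · rw [infDist_coordAxis, Real.sqrt_eq_one, Fin.sum_univ_three_of_ne hij hil hjl]
    simp [hω, hij.symm, hil.symm, hjl.symm]
  · refine (mem_compactFaces_iff hfin hF one_ne_zero).2 ⟨⟨_, fun m => ?_, d, fun ν hν => ?_, hTeq⟩,
      hTdim⟩
    · have h1 : (0 : ℝ) ≤ (EuclideanSpace.single j (1 : ℝ)) m := by
        rw [PiLp.single_apply]; split_ifs <;> norm_num
      exact add_pos_of_pos_of_nonneg (hw m) h1
    · rw [← weightForm_latticePoint]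
      refine (hwF ν hν).trans ?_
      rw [← weightForm_latticePoint]
      simp [weightForm_apply, add_mul, Finset.sum_add_distrib]
  · rw [hText.extremePoints_eq]
    ext x
    constructor
    · rintro ⟨hxT, hx⟩
      refine ⟨hx, ?_⟩
      rintro rfl
      have := hxT.2
      rw [hW1] at this
      norm_num at this
    · rintro ⟨hx, hxW⟩
      refine ⟨⟨hx.1, ?_⟩, hx⟩
      simpa using (hX x (extremePoints_convexHull_subset hx)).resolve_left hxW

/-! ### Reduction to finitely many exponents and conclusion. -/

/-- Dickson's lemma: the minimal elements of `A` form an antichain in a well-quasi-order, hence a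
finite set, and every element of `A` lies above one of them. -/
theorem exists_finite_latticeUpperSet_eq {n : ℕ} (A : Set (Fin n → ℕ)) :
    ∃ F ⊆ A, F.Finite ∧ latticeUpperSet F = latticeUpperSet A ∧ ∀ ν ∈ A, ∃ μ ∈ F, μ ≤ ν := by
  have hle : ∀ ν ∈ A, ∃ μ ∈ {μ | Minimal (· ∈ A) μ}, μ ≤ ν := fun ν hν => by
    obtain ⟨μ, h1, h2⟩ := exists_minimal_le_of_wellFoundedLT (· ∈ A) ν hν
    exact ⟨μ, h2, h1⟩
  refine ⟨{μ | Minimal (· ∈ A) μ}, fun μ hμ => hμ.prop, ?_, ?_, hle⟩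
  · exact (setOfPred_minimal_antichain _).finite_of_partiallyWellOrderedOn
      (Set.isPWO_of_wellQuasiOrderedLE _)
  · ext x
    constructor
    · rintro ⟨ν, hν, hx⟩
      exact ⟨ν, hν.prop, hx⟩
    · rintro ⟨ν, hν, hx⟩
      obtain ⟨μ, hμ, hμν⟩ := hle ν hν
      exact ⟨μ, hμ, fun i => le_trans (by exact_mod_cast hμν i) (hx i)⟩

theorem compactFaces_two_subset_iff {f : (Fin 3 → ℂ) → ℂ} (hf : IsIsolatedSingularity f) :
    compactFaces f 2 ⊆ exceptionalFaces f ↔ (compactFaces f 1 ∩ specialSegments).Nonempty := by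
  obtain ⟨F, hFA, hfin, hFeq, hFle⟩ := exists_finite_latticeUpperSet_eq {ν | taylorCoeff f ν ≠ 0}
  have hF : newtonDiagram f = convexHull ℝ (latticeUpperSet F) := by
    rw [hFeq]; rfl
  constructor
  · intro hE
    refine compactFaces_inter_specialSegments_nonempty hfin hF
      (hasSpecialEdge_of_exceptional hfin
        (fun ν hν => two_le_sum_of_taylorCoeff_ne_zero hf.map_zero hf.grad_zero (hFA hν))
        (fun i => ?_) (fun j => ?_) fun u hu huF hrank => ?_)
    · obtain ⟨ν, hν, j, hji, hj, hl⟩ := hf.exists_taylorCoeff_near_axis i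
      obtain ⟨μ, hμ, hμν⟩ := hFle ν hν
      exact ⟨μ, hμ, j, hji, (hμν j).trans hj, fun l h1 h2 =>
        Nat.le_zero.1 ((hμν l).trans (hl l h1 h2).le)⟩
    · obtain ⟨ν, hν, hj⟩ := hf.exists_taylorCoeff_on_hyperplane j
      obtain ⟨μ, hμ, hμν⟩ := hFle ν hν
      exact ⟨μ, hμ, Nat.le_zero.1 ((hμν j).trans hj.le)⟩
    · have hdim := finrank_vectorSpan_activePoints (m := 2) (F := F) (u := WithLp.toLp 2 u)
        (c := 1) (fun h => (hu 0).ne' (congrArg (fun x : EuclideanSpace ℝ (Fin 3) => x 0) h))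
        fun v hv => hrank v fun ν hν h => hv ν ⟨hν, h⟩
      obtain ⟨i, hi⟩ := hE ((mem_compactFaces_iff hfin hF two_ne_zero).2
        ⟨⟨WithLp.toLp 2 u, hu, 1, huF, rfl⟩, hdim⟩)
      obtain ⟨j, hij, ω, hω, hωj, hωl, h⟩ := hi.exists_lattice (hfin.subset fun ν h => h.1)
        (exists_coord_ne_zero_of_finrank (m := 1) hu hdim)
      exact ⟨i, j, hij, ω, hω.1, hωj, hωl, fun ν hν h1 => h ν ⟨hν, h1⟩⟩
  · rintro ⟨_, hI, l, k, hk, rfl⟩ S hS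
    obtain ⟨⟨u, hu, c, huF, hseg⟩, -⟩ := (mem_compactFaces_iff hfin hF one_ne_zero).1 hI
    obtain ⟨i, j, hij, hil, hjl⟩ : ∃ i j : Fin 3, i ≠ j ∧ i ≠ l ∧ j ≠ l := by
      clear * -; revert l; decide
    have hact := eq_pair_of_specialSegment_eq hij hil hjl hseg
    obtain ⟨⟨w, hw, d, hwF, rfl⟩, -⟩ := (mem_compactFaces_iff hfin hF two_ne_zero).1 hS
    rcases forall_active_of_special_edge hij hil hjl (by omega) hu huF hact hw hwF with h | h
    · exact ⟨i, isExceptionalFace_of_forall hfin hF hij hil hjl hw hwF hS fun ν hν =>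
        h ν hν.1 hν.2⟩
    · exact ⟨j, isExceptionalFace_of_forall hfin hF hij.symm hjl hil hw hwF hS fun ν hν => by
        rw [add_comm]; exact h ν hν.1 hν.2⟩

theorem theorem4 (f : (Fin 3 → ℂ) → ℂ) (hf : IsIsolatedSingularity f) :
    (compactFaces f 2 = ∅ ∨
        (compactFaces f 2 = exceptionalFaces f ∧ exceptionalFaces f ≠ ∅)) ↔
      (compactFaces f 1 ∩ specialSegments).Nonempty := by
  rw [← compactFaces_two_subset_iff hf]
  constructor
  · rintro (h | ⟨h, -⟩)
    · rw [h]; exact Set.empty_subset _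
    · exact h.subset
  · intro h
    have h1 : compactFaces f 2 = exceptionalFaces f := h.antisymm fun S ⟨_, hS⟩ => hS.1
    rcases (compactFaces f 2).eq_empty_or_nonempty with h0 | h0
    · exact Or.inl h0
    · exact Or.inr ⟨h1, h1 ▸ h0.ne_empty⟩
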